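/- Let $k,n,\delta$ be positive integers with $k<n$, let $q$ be a prime power with $q>n$, let $s\ge 1$, and let $K=\mathbb F_{q^s}\supseteq \mathbb F_q$. Let $\alpha=(\alpha_1,\dots,\alpha_n)\in(\mathbb F_q^*)^n$ have pairwise distinct entries and let $\gamma\in K$ be a root of an irreducible polynomial of degree $s$ over $\mathbb F_q$ (such $\alpha,\gamma$ exist). **Convolutional codes.** A submodule $\mathcal C\subseteq K[z]^n$ is an $(n,k,\delta)$ convolutional code if $\mathcal C=\{u(z)G(z): u(z)\in K[z]^k\}$ for some $G(z)\in K[z]^{k\times n}$ of full row rank whose $k\times k$ minors have highest degree $\delta$. For $v(z)=\sum_i v_iz^i\in K[z]^n$ and $j\ge 0$, let $\mathrm{wt}(v_{[0,j]})$ be the sum of the Hamming weights of $v_0,\dots,v_j\in K^n$, and let $\mathrm d_j^{\mathrm c}(\mathcal C)=\min\{\mathrm{wt}(v_{[0,j]}): v\in\mathcal C,\ v_0\neq 0\}$. An $(n,k,\delta)$ convolutional code is maximum distance profile (MDP) if $\mathrm d_j^{\mathrm c}(\mathcal C)=(n-k)(j+1)+1$ for all $0\le j\le \lfloor \delta/k\rfloor+\lfloor\delta/(n-k)\rfloor$.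 **WRS codes.** Put $m=\lceil\delta/k\rceil$ and $t=\delta-(m-1)k$. For $i\ge 0$ let $M_i\in K^{k\times n}$ be the matrix whose rows, numbered from bottom to top by $j=0,\dots,k-1$, are $$\gamma^{\binom i2 k+ji}\,\bigl(\alpha_1^{ik+j},\dots,\alpha_n^{ik+j}\bigr)$$ (with $\binom ab=0$ for $a<b$). Let $N_{m,t}$ be $M_m$ with all but its last $t$ rows replaced by $0$. Put $G_i=M_i$ for $0\le i\le m-1$, $G_m=N_{m,t}$ and $G(z)=\sum_{i=0}^m G_iz^i$. The weighted Reed–Solomon (WRS) convolutional code is $\mathcal C_{k,n}^\delta(\gamma,\alpha)=\{u(z)G(z):u(z)\in K[z]^k\}$. The dual WRS convolutional code is $\mathcal D_{k,n}^\delta(\gamma,\alpha)=\{v(z)\in K[z]^n : H(z)v(z)^\top=0\}$, where $H(z)$ is the matrix $G(z)$ constructed with $n-k$ in place of $k$; that is, $\mathcal D_{k,n}^\delta(\gamma,\alpha)=\mathcal C_{n-k,n}^\delta(\gamma,\alpha)^\perp$. **Theorem.** 1. If $$s> \frac{\delta^3}{2}\left(\frac{1}{n-k}+\frac{1}{3k}\right)+\frac{\delta^2}{2}\left(\frac{3}{2}-\frac{1}{n-k}-\frac{1}{2k}\right)+\delta\left(\frac{k}{12}-\frac{3}{4}\right),$$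 then every WRS convolutional code $\mathcal C_{k,n}^\delta(\gamma,\alpha)$ as above is an $(n,k,\delta)$ MDP convolutional code over $\mathbb F_{q^s}$. 2. If $$s> \frac{\delta^3}{2}\left(\frac{1}{3(n-k)}+\frac{1}{k}\right)+\frac{\delta^2}{2}\left(\frac{3}{2}-\frac{1}{2(n-k)}-\frac{1}{k}\right)+\delta\left(\frac{n-k}{12}-\frac{3}{4}\right),$$ then every dual WRS convolutional code $\mathcal D_{k,n}^\delta(\gamma,\alpha)$ as above is an $(n,k,\delta)$ MDP convolutional code over $\mathbb F_{q^s}$. -/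

import Mathlib

open Polynomial Matrix

noncomputable section

namespace ConvCode

/-! # Convolutional codes over a field `K` -/

section General

variable {K : Type*} [Field K] {n : ℕ}

/-- `G` is a generator matrix of `C`: its rows are linearly independent over `K[z]`
(full row rank) and `C = {u(z) G(z) | u(z) ∈ K[z]^k}`. -/
def IsGeneratorMatrix {k : ℕ} (C : Submodule K[X] (Fin n → K[X]))
    (G : Matrix (Fin k) (Fin n) K[X]) : Prop :=
  LinearIndependent K[X] G.row ∧ C = LinearMap.range G.vecMulLinear

/-- The highest degree of the `k × k` minors of a `k × n` polynomial matrix. -/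
def maxMinorDegree {k : ℕ} (G : Matrix (Fin k) (Fin n) K[X]) : ℕ :=
  Finset.univ.sup fun c : Fin k ↪o Fin n => (G.submatrix id c).det.natDegree

/-- `C` is an `(n, k, δ)` convolutional code over `K`: it has a full row rank `k × n` generator
matrix, and its degree (the highest degree of the full size minors of a generator matrix; two
generator matrices differ by a unimodular factor, so the choice is irrelevant) is `δ`. -/
def IsConvCode (k δ : ℕ) (C : Submodule K[X] (Fin n → K[X])) : Prop :=
  ∃ G : Matrix (Fin k) (Fin n) K[X], IsGeneratorMatrix C G ∧ maxMinorDegree G = δ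

/-- The coefficient `v_i ∈ K^n` of `z^i` in `v(z) ∈ K[z]^n`. -/
def coeffVec (v : Fin n → K[X]) (i : ℕ) : Fin n → K := fun l => (v l).coeff i

open Classical in
/-- The weight of `v_[0,j](z) = ∑_{i ≤ j} v_i z^i`: the sum of the Hamming weights of
`v_0, …, v_j`. -/
def truncWeight (j : ℕ) (v : Fin n → K[X]) : ℕ :=
  ∑ i ∈ Finset.range (j + 1), hammingNorm (coeffVec v i)

/-- The `j`-th column distance of `C`: the minimum of `wt(v_[0,j])` over the `v ∈ C` with
`v_0 ≠ 0`. -/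
def columnDistance (C : Submodule K[X] (Fin n → K[X])) (j : ℕ) : ℕ :=
  sInf {w | ∃ v ∈ C, coeffVec v 0 ≠ 0 ∧ truncWeight j v = w}

/-- `C` is an `(n, k, δ)` convolutional code which is maximum distance profile:
`d_j^c(C) = (n - k)(j + 1) + 1` for every `0 ≤ j ≤ L = ⌊δ/k⌋ + ⌊δ/(n-k)⌋`. -/
def IsMDP (k δ : ℕ) (C : Submodule K[X] (Fin n → K[X])) : Prop :=
  IsConvCode k δ C ∧
    ∀ j ≤ δ / k + δ / (n - k), columnDistance C j = (n - k) * (j + 1) + 1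

end General

/-! # Weighted Reed-Solomon convolutional codes -/

section WRS

variable {K : Type*} [Field K] {n : ℕ}

/-- The matrix `M_i`. Its rows are numbered from the bottom by `j = 0, …, k-1` (so the row with
index `r` has `j = k - 1 - r = r.rev`), and row `j` is `γ^(binom(i,2) k + j i) α_c^(i k + j)`. -/
def wrsM (k : ℕ) (γ : K) (α : Fin n → K) (i : ℕ) : Matrix (Fin k) (Fin n) K :=
  Matrix.of fun r c =>
    γ ^ (i.choose 2 * k + (r.rev : ℕ) * i) * α c ^ (i * k + (r.rev : ℕ))

/-- The matrix `N_{i,t}`: the last `t` rows agree with those of `M_i`, the others are zero. -/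
def wrsN (k : ℕ) (γ : K) (α : Fin n → K) (i t : ℕ) : Matrix (Fin k) (Fin n) K :=
  Matrix.of fun r c => if (r.rev : ℕ) < t then wrsM k γ α i r c else 0

/-- The memory `m = ⌈δ / k⌉`. -/
def wrsMemory (k δ : ℕ) : ℕ := ⌈(δ : ℚ) / (k : ℚ)⌉₊

/-- The coefficients `G_i = M_i` for `i < m` and `G_m = N_{m,t}`, where `t = δ - (m-1)k`. -/
def wrsCoeff (k δ : ℕ) (γ : K) (α : Fin n → K) (i : ℕ) : Matrix (Fin k) (Fin n) K :=
  if i < wrsMemory k δ then wrsM k γ α i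
  else wrsN k γ α i (δ - (wrsMemory k δ - 1) * k)

/-- `G(z) = ∑_{i=0}^m G_i z^i`. -/
def wrsMatrix (k δ : ℕ) (γ : K) (α : Fin n → K) : Matrix (Fin k) (Fin n) K[X] :=
  Matrix.of fun r c =>
    ∑ i ∈ Finset.range (wrsMemory k δ + 1), C (wrsCoeff k δ γ α i r c) * X ^ i

/-- The WRS convolutional code `C_{k,n}^δ(γ, α) = {u(z) G(z)}`. -/
def wrsCode (k δ : ℕ) (γ : K) (α : Fin n → K) : Submodule K[X] (Fin n → K[X]) :=
  LinearMap.range (wrsMatrix k δ γ α).vecMulLinear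

/-- The dual WRS convolutional code `D_{k,n}^δ(γ, α) = {v(z) | H(z) v(z)ᵀ = 0}`, whose parity-check
matrix `H(z)` is the matrix `G(z)` above with `n - k` in place of `k`. -/
def dualWRSCode (k δ : ℕ) (γ : K) (α : Fin n → K) : Submodule K[X] (Fin n → K[X]) :=
  LinearMap.ker (wrsMatrix (n - k) δ γ α).mulVecLin

/-- `D_{k,n}^δ(γ, α)` is the orthogonal of `C_{n-k,n}^δ(γ, α)`. -/
theorem mem_dualWRSCode_iff (k δ : ℕ) (γ : K) (α : Fin n → K) (v : Fin n → K[X]) :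
    v ∈ dualWRSCode k δ γ α ↔ ∀ c ∈ wrsCode (n - k) δ γ α, c ⬝ᵥ v = 0 := by
  simp only [dualWRSCode, wrsCode, LinearMap.mem_ker, Matrix.mulVecLin_apply,
    LinearMap.mem_range, Matrix.vecMulLinear_apply]
  constructor
  · rintro h _ ⟨u, rfl⟩
    rw [← Matrix.dotProduct_mulVec, h, dotProduct_zero]
  · intro h
    refine dotProduct_eq _ _ fun u => ?_
    rw [dotProduct_comm, Matrix.dotProduct_mulVec, h _ ⟨u, rfl⟩, zero_dotProduct]

/-- Admissible data for a WRS code over an extension `K` of `F`: the `α_i` are pairwise distinct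
nonzero elements of `F`, and `γ ∈ K` is a root of an irreducible polynomial over `F` of
degree `s`. -/
def WRSData {F : Type*} [Field F] [Algebra F K] (s : ℕ) (α : Fin n → F) (γ : K) : Prop :=
  Function.Injective α ∧ (∀ i, α i ≠ 0) ∧
    ∃ f : F[X], Irreducible f ∧ f.natDegree = s ∧ aeval γ f = 0

end WRS

end ConvCode

end

/-! With `e = ik + j`, row `j` of `M_i` carries the monomial `γ ^ wexp k e * x ^ e`, so `G(z)` lists
these monomials for `e < δ + k`: `e % k` selects the row and `e / k` the power of `z`. In a
truncated sliding matrix, row `ρ` and a column of block `d` meet in the monomial with `e = ρ - kd`,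
or in zero if `e` leaves the window `[0, δ + k)`. Since `wexp k` is discretely quadratic, `wexp k (ρ
- kd)` is a function of `ρ` plus a function of `d` minus `ρ * d` (`wexp_sub_mul`).

Treat `γ` as an indeterminate and sort the columns by block. The Leibniz term of `σ` then has
exponent `const - ∑ i * d (σ i)`. By the rearrangement inequality, only permutations preserving the
block of every column have the exponent of the diagonal, and the coefficient there is a block
diagonal determinant of Vandermonde type over `F`. It is nonzero because the `α_i` are distinct and
nonzero, provided the diagonal lies in the window (`det_polyEntry_ne_zero`). The degree in `γ` is at
most `degBound`, which the hypothesis on `s` makes smaller than the degree of `γ` over `F`, so the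
minor does not vanish at `γ` (`det_entry_ne_zero`).

The lower bound on column distances goes by strong induction on `j`. A codeword of too small
truncated weight yields a square sliding system: its columns are zeros of the codeword for a WRS
code, and a set containing its support for a dual code. The bound for smaller `j` supplies the count
condition that puts the diagonal in the window (`det_sliding_ne_zero`), and nonsingularity forces
`v_0 = 0`. The upper bound comes from explicit codewords built with adjugates and an inverse of a
minor modulo `z ^ (j + 1)`.

The degree of a WRS code is read off the row degrees of `G(z)`, which sum to `δ`. For the dual,
`H(z)` is shown to be right invertible by another nonsingular sliding system, and the minors of a
kernel basis are then bordered determinants of `H(z)` up to a unit. -/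

namespace ConvCode

/-! ## The exponents of the weights -/

/-- The exponent of `γ` attached to the monomial `x ^ e` in a WRS code of dimension `k`. -/
def wexp (k e : ℕ) : ℕ := ∑ x ∈ Finset.range e, x / k

/-- Hermite's identity: passing from `δ` to `δ + 1` trades the term `δ / k` for `(δ + k) / k`, which
is one larger. It also shows later that the row degrees of `G(z)` add up to `δ`. -/
theorem sum_add_div (k δ : ℕ) (hk : 0 < k) : ∑ j ∈ Finset.range k, (δ + j) / k = δ := by
  induction δ with
  | zero =>
    refine Finset.sum_eq_zero fun j hj => ?_
    simpa using Nat.div_eq_of_lt (Finset.mem_range.1 hj)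
  | succ δ ih =>
    have h1 := Finset.sum_range_succ (fun j => (δ + j) / k) k
    have h2 := Finset.sum_range_succ' (fun j => (δ + j) / k) k
    have h3 : (δ + k) / k = δ / k + 1 := Nat.add_div_right _ hk
    have h4 : ∑ j ∈ Finset.range k, (δ + 1 + j) / k
        = ∑ j ∈ Finset.range k, (δ + (j + 1)) / k :=
      Finset.sum_congr rfl fun j _ => by rw [add_assoc, add_comm 1 j]
    simp only [add_zero] at h2
    omega

theorem wexp_mono (k : ℕ) : Monotone (wexp k) := fun _ _ h =>
  Finset.sum_le_sum_of_subset (Finset.range_mono h)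

theorem wexp_add_self (k e : ℕ) (hk : 0 < k) : wexp k (e + k) = wexp k e + e := by
  rw [wexp, Finset.sum_range_add, sum_add_div k e hk, wexp]

theorem wexp_add_mul (k e d : ℕ) (hk : 0 < k) :
    wexp k (e + k * d) = wexp k e + d * e + k * d.choose 2 := by
  induction d with
  | zero => simp
  | succ d ih =>
    rw [Nat.mul_succ, ← add_assoc, wexp_add_self _ _ hk, ih, Nat.choose_succ_succ' d 1,
      Nat.choose_one_right]
    ring

theorem wexp_of_le (k e : ℕ) (h : e ≤ k) : wexp k e = 0 :=
  Finset.sum_eq_zero fun _ hx => Nat.div_eq_of_lt ((Finset.mem_range.1 hx).trans_le h)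

theorem wexp_mul_add (k i j : ℕ) (hj : j < k) :
    wexp k (i * k + j) = i.choose 2 * k + j * i := by
  rw [add_comm, mul_comm i k, wexp_add_mul k j i (by omega), wexp_of_le k j hj.le]
  ring

/-- The only term mixing `ρ` and `d` is the product `ρ * d`; this is what lets the rearrangement
inequality compare Leibniz terms. -/
theorem wexp_sub_mul (k d ρ : ℕ) (hk : 0 < k) (h : k * d ≤ ρ) :
    wexp k (ρ - k * d) + ρ * d = wexp k ρ + k * (d + 1).choose 2 := by
  obtain ⟨e, rfl⟩ := Nat.exists_eq_add_of_le' h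
  rw [Nat.add_sub_cancel, wexp_add_mul k e d hk]
  have h2 : d.choose 2 + (d + 1).choose 2 = d * d := by
    have h1 : (d + 1).choose 2 = d + d.choose 2 := by
      rw [Nat.choose_succ_succ' d 1, Nat.choose_one_right]
    have h3 := Nat.choose_two_right d
    have h4 := Nat.even_mul_pred_self d
    obtain ⟨c, hc⟩ := h4
    rcases d with _ | d
    · simp
    · rw [h1, h3, hc]
      simp only [Nat.add_sub_cancel] at hc
      have : (c + c) / 2 = c := by omega
      rw [this]
      nlinarith
  have : k * (d * d) = k * d.choose 2 + k * (d + 1).choose 2 := by rw [← h2]; ring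
  linarith

/-- The same exchange as in `sum_add_div`: here one step gains `wexp k (δ + k) - wexp k δ = δ`. -/
theorem sum_wexp_add (k δ : ℕ) (hk : 0 < k) :
    ∑ j ∈ Finset.range k, wexp k (δ + j) = δ.choose 2 := by
  induction δ with
  | zero =>
    refine Finset.sum_eq_zero fun j hj => ?_
    rw [zero_add, wexp_of_le _ _ (Finset.mem_range.1 hj).le]
  | succ δ ih =>
    have h1 := Finset.sum_range_succ (fun j => wexp k (δ + j)) k
    have h2 := Finset.sum_range_succ' (fun j => wexp k (δ + j)) k
    have h3 := wexp_add_self k δ hk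
    have h4 : ∑ j ∈ Finset.range k, wexp k (δ + 1 + j)
        = ∑ j ∈ Finset.range k, wexp k (δ + (j + 1)) :=
      Finset.sum_congr rfl fun j _ => by rw [add_assoc, add_comm 1 j]
    have h5 : (δ + 1).choose 2 = δ + δ.choose 2 := by
      rw [Nat.choose_succ_succ' δ 1, Nat.choose_one_right]
    simp only [add_zero] at h2
    omega

/-- The largest weight exponent in row `ρ` of a sliding matrix. -/
def rowExp (k δ ρ : ℕ) : ℕ := wexp k (if ρ < δ then ρ else δ + (ρ - δ) % k)

/-- The exponents in row `ρ` are congruent to `ρ` modulo `k`, at most `ρ` and below `δ + k`. If `ρ ≥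
δ`, the largest candidate is the representative of `ρ` in `[δ, δ + k)`. -/
theorem wexp_sub_mul_le_rowExp (k δ ρ d : ℕ) (h1 : k * d ≤ ρ) (h2 : ρ < k * d + δ + k) :
    wexp k (ρ - k * d) ≤ rowExp k δ ρ := by
  refine wexp_mono k ?_
  split_ifs with h
  · omega
  · obtain hd | hd := le_or_gt (ρ - k * d) δ
    · omega
    · have h3 : ρ - δ = (ρ - k * d - δ) + k * d := by omega
      rw [h3, Nat.add_mul_mod_self_left, Nat.mod_eq_of_lt (by omega)]
      omega

/-- The bound for the degree in `γ` of the relevant minors. -/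
def degBound (k δ p : ℕ) : ℕ := ∑ e ∈ Finset.range δ, wexp k e + p * δ.choose 2

/-- Beyond the first `δ` rows, `rowExp` is periodic, and each full period of `k` rows contributes
`δ.choose 2` by `sum_wexp_add`. -/
theorem sum_rowExp_le (k δ p M : ℕ) (hk : 0 < k) (hM : M ≤ δ + k * p) :
    ∑ ρ ∈ Finset.range M, rowExp k δ ρ ≤ degBound k δ p := by
  refine (Finset.sum_le_sum_of_subset (Finset.range_mono hM)).trans (le_of_eq ?_)
  rw [Finset.sum_range_add, degBound]
  congr 1
  · refine Finset.sum_congr rfl fun e he => ?_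
    rw [rowExp, if_pos (Finset.mem_range.1 he)]
  · have h : ∀ x, rowExp k δ (δ + x) = wexp k (δ + x % k) := fun x => by
      rw [rowExp, if_neg (by omega), Nat.add_sub_cancel_left]
    simp only [h]
    clear hM
    induction p with
    | zero => simp
    | succ p ih =>
      rw [Nat.mul_succ, Finset.sum_range_add, ih, Nat.succ_mul]
      congr 1
      rw [← sum_wexp_add k δ hk]
      refine Finset.sum_congr rfl fun j hj => ?_
      rw [Nat.mul_add_mod, Nat.mod_eq_of_lt (Finset.mem_range.1 hj)]

theorem wexp_le_degBound (k δ p e : ℕ) (hk : 0 < k) (hp : 0 < p) (he : e < δ + k) :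
    wexp k e ≤ degBound k δ p := by
  have h1 : wexp k e ≤ rowExp k δ e := by
    simpa using wexp_sub_mul_le_rowExp k δ e 0 (by simp) (by simpa using he)
  refine h1.trans (le_trans ?_ (sum_rowExp_le k δ p (δ + k * p) hk le_rfl))
  refine Finset.single_le_sum (f := rowExp k δ) (fun _ _ => Nat.zero_le _)
    (Finset.mem_range.2 (he.trans_le ?_))
  have := Nat.le_mul_of_pos_right k hp
  omega

/-- The right side is what remains of the stated bound on `s` after removing `(δ / r + 1) * (δ * (δ
- 1) / 2)`, with real division. Its increment at `δ` is `δ² / (2k) + δ / 2 + (k - 1 / k) / 12`,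
which dominates `wexp k δ`. -/
theorem sum_wexp_le (k δ : ℕ) (hk : 0 < k) :
    ((∑ e ∈ Finset.range δ, wexp k e : ℕ) : ℝ) ≤
      (δ : ℝ) ^ 3 / (6 * k) + (δ : ℝ) ^ 2 / 4 + k * δ / 12 - (δ : ℝ) ^ 2 / (4 * k) - δ / 4 := by
  have hk1 : (1 : ℝ) ≤ k := by exact_mod_cast hk
  have hk0 : (0 : ℝ) < k := by linarith
  induction δ with
  | zero => simp
  | succ δ ih =>
    rw [Finset.sum_range_succ, Nat.cast_add]
    have hf : (wexp k δ : ℝ) ≤ (δ : ℝ) ^ 2 / (2 * k) + δ / 2 := by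
      obtain ⟨i, j, hj, rfl⟩ : ∃ i j, j < k ∧ δ = i * k + j :=
        ⟨δ / k, δ % k, Nat.mod_lt _ hk, (Nat.div_add_mod' δ k).symm⟩
      rw [wexp_mul_add k i j hj]
      have hc : ((i.choose 2 : ℕ) : ℝ) = i * (i - 1) / 2 := Nat.cast_choose_two ℝ i
      push_cast
      rw [hc]
      have : ((i : ℝ) * k + j) ^ 2 / (2 * k) = k * i ^ 2 / 2 + i * j + (j : ℝ) ^ 2 / (2 * k) := by
        field_simp
        ring
      rw [this]
      have h1 : 0 ≤ (j : ℝ) ^ 2 / (2 * k) := by positivity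
      have h2 : (0 : ℝ) ≤ i * k := by positivity
      have h3 : (0 : ℝ) ≤ j := by positivity
      nlinarith
    have hinv : 1 / (k : ℝ) ≤ k := by
      rw [div_le_iff₀ hk0]; nlinarith
    have e1 : ((δ + 1 : ℕ) : ℝ) ^ 3 / (6 * k) + ((δ + 1 : ℕ) : ℝ) ^ 2 / 4 + k * ((δ + 1 : ℕ) : ℝ) / 12
        - ((δ + 1 : ℕ) : ℝ) ^ 2 / (4 * k) - ((δ + 1 : ℕ) : ℝ) / 4
        = ((δ : ℝ) ^ 3 / (6 * k) + (δ : ℝ) ^ 2 / 4 + k * δ / 12 - (δ : ℝ) ^ 2 / (4 * k) - δ / 4)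
          + ((δ : ℝ) ^ 2 / (2 * k) + δ / 2 + (k - 1 / k) / 12) := by
      push_cast
      field_simp
      ring
    rw [e1]
    linarith

theorem degBound_lt (k r δ s : ℕ) (hk : 0 < k)
    (h : (δ : ℝ) ^ 3 / 2 * (1 / (r : ℝ) + 1 / (3 * k))
        + (δ : ℝ) ^ 2 / 2 * (3 / 2 - 1 / (r : ℝ) - 1 / (2 * k))
        + (δ : ℝ) * ((k : ℝ) / 12 - 3 / 4) < (s : ℝ)) :
    degBound k δ (δ / r + 1) < s := by
  have h1 := sum_wexp_le k δ hk
  have h2 : ((δ / r : ℕ) : ℝ) ≤ (δ : ℝ) / r := Nat.cast_div_le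
  have hc : ((δ.choose 2 : ℕ) : ℝ) = δ * (δ - 1) / 2 := Nat.cast_choose_two ℝ δ
  have h3 : (0 : ℝ) ≤ (δ.choose 2 : ℕ) := by positivity
  have h4 := mul_le_mul_of_nonneg_right h2 h3
  have h5 : ((degBound k δ (δ / r + 1) : ℕ) : ℝ) < s := by
    refine lt_of_le_of_lt ?_ h
    rw [degBound, Nat.cast_add, Nat.cast_mul, Nat.cast_add, Nat.cast_one]
    rw [hc] at h4 ⊢
    have hk0 : (k : ℝ) ≠ 0 := by exact_mod_cast hk.ne'
    have e : (δ : ℝ) ^ 3 / 2 * (1 / (r : ℝ) + 1 / (3 * k))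
        + (δ : ℝ) ^ 2 / 2 * (3 / 2 - 1 / (r : ℝ) - 1 / (2 * k))
        + (δ : ℝ) * ((k : ℝ) / 12 - 3 / 4)
        = ((δ : ℝ) ^ 3 / (6 * k) + (δ : ℝ) ^ 2 / 4 + k * δ / 12 - (δ : ℝ) ^ 2 / (4 * k) - δ / 4)
          + (δ / r * (δ * (δ - 1) / 2) + δ * (δ - 1) / 2) := by
      simp only [div_eq_mul_inv, mul_inv]
      ring
    rw [e]
    linarith
  exact_mod_cast h5

/-! ## Nonsingularity of the sliding matrices -/

/-- Divided by `X ^ a`, the combination is a polynomial of degree less than `s.card` with `s.card`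
distinct roots, so it is zero. The exponents being distinct, the `w i` are its coefficients. -/
theorem eq_zero_of_sum_mul_pow_eq_zero {F ι : Type*} [Field F] (s : Finset ι) (e : ι → ℕ)
    (a : ℕ) (he : Set.InjOn e s) (hl : ∀ i ∈ s, a ≤ e i) (hu : ∀ i ∈ s, e i < a + s.card)
    (x : ι → F) (hx : Set.InjOn x s) (hx0 : ∀ i ∈ s, x i ≠ 0) (w : ι → F)
    (hw : ∀ c ∈ s, ∑ i ∈ s, w i * x c ^ e i = 0) : ∀ i ∈ s, w i = 0 := by
  classical
  set p : F[X] := ∑ i ∈ s, monomial (e i - a) (w i) with hp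
  have hp0 : p = 0 := by
    by_cases hs : s.card = 0
    · rw [Finset.card_eq_zero.1 hs] at hp
      simpa using hp
    refine eq_zero_of_natDegree_lt_card_of_eval_eq_zero' p (s.image x) ?_ ?_
    · intro y hy
      obtain ⟨c, hc, rfl⟩ := Finset.mem_image.1 hy
      have h1 : x c ^ a * p.eval (x c) = 0 := by
        rw [← hw c hc, hp, eval_finsetSum, Finset.mul_sum]
        refine Finset.sum_congr rfl fun i hi => ?_
        rw [eval_monomial, mul_left_comm, ← pow_add, Nat.add_sub_cancel' (hl i hi)]
      exact (mul_eq_zero.1 h1).resolve_left (pow_ne_zero _ (hx0 c hc))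
    · rw [Finset.card_image_of_injOn hx]
      refine lt_of_le_of_lt (natDegree_sum_le_of_forall_le (n := s.card - 1) _ _ fun i hi => ?_)
        (by omega)
      refine (natDegree_monomial_le _).trans ?_
      have := hl i hi
      have := hu i hi
      omega
  intro i hi
  have h2 : p.coeff (e i - a) = w i := by
    rw [hp, finsetSum_coeff, Finset.sum_eq_single i]
    · rw [coeff_monomial, if_pos rfl]
    · intro b hb hbi
      rw [coeff_monomial, if_neg]
      intro h
      refine hbi (he hb hi ?_)
      have := hl i hi
      have := hl b hb
      omega
    · exact fun h => absurd hi h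
  rw [← h2, hp0, coeff_zero]

theorem det_pow_ne_zero {F : Type*} [Field F] {k : ℕ} (e : Fin k → ℕ) (a : ℕ)
    (he : Function.Injective e) (hl : ∀ i, a ≤ e i) (hu : ∀ i, e i < a + k)
    (x : Fin k → F) (hx : Function.Injective x) (hx0 : ∀ i, x i ≠ 0) (b : Fin k → F)
    (hb : ∀ i, b i ≠ 0) :
    (Matrix.of fun i c => b i * x c ^ e i).det ≠ 0 := by
  intro h0
  obtain ⟨w, hw0, hw⟩ := exists_vecMul_eq_zero_iff.2 h0
  refine hw0 (funext fun i => ?_)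
  have := eq_zero_of_sum_mul_pow_eq_zero Finset.univ e a he.injOn (fun i _ => hl i)
    (fun i _ => by simpa using hu i) x hx.injOn (fun i _ => hx0 i) (fun i => w i * b i)
    (fun c _ => by
      have := congrFun hw c
      simpa [vecMul, dotProduct, mul_assoc] using this) i (Finset.mem_univ i)
  exact (mul_eq_zero.1 this).resolve_right (hb i)

/-- The entry in row `ρ` of a sliding matrix of a WRS code, in a column attached to the evaluation
point `x` which lies `d` blocks away. -/
def entry {K : Type*} [Field K] (k δ : ℕ) (γ : K) (ρ d : ℕ) (x : K) : K :=
  if k * d ≤ ρ ∧ ρ < k * d + δ + k then γ ^ wexp k (ρ - k * d) * x ^ (ρ - k * d) else 0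

/-- The entry of a sliding matrix as a polynomial in the weight `γ`. -/
noncomputable def polyEntry {F : Type*} [Field F] (k δ ρ d : ℕ) (x : F) : F[X] :=
  if k * d ≤ ρ ∧ ρ < k * d + δ + k then monomial (wexp k (ρ - k * d)) (x ^ (ρ - k * d)) else 0

theorem aeval_polyEntry {F K : Type*} [Field F] [Field K] [Algebra F K] (k δ : ℕ) (γ : K)
    (ρ d : ℕ) (x : F) :
    aeval γ (polyEntry k δ ρ d x) = entry k δ γ ρ d (algebraMap F K x) := by
  rw [polyEntry, entry]
  split_ifs
  · rw [aeval_monomial, map_pow, mul_comm]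
  · rw [map_zero]

/-! ### The sliding determinant as a polynomial in the weight -/

section Det

variable {F : Type*} [Field F] {M : ℕ} (k δ : ℕ) (d : Fin M → ℕ) (x : Fin M → F)

theorem natDegree_det_polyEntry_le (p : ℕ) (hk : 0 < k) (hM : M ≤ δ + k * p) :
    (Matrix.of fun i c : Fin M => polyEntry k δ i (d c) (x c)).det.natDegree
      ≤ degBound k δ p := by
  rw [← det_transpose, det_apply']
  refine natDegree_sum_le_of_forall_le _ _ fun σ _ => ?_
  refine natDegree_mul_le.trans ?_
  rw [natDegree_intCast, zero_add]
  refine (natDegree_prod_le _ _).trans ?_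
  refine le_trans ?_ (sum_rowExp_le k δ p M hk hM)
  rw [← Fin.sum_univ_eq_sum_range]
  refine Finset.sum_le_sum fun i _ => ?_
  rw [transpose_apply, of_apply, polyEntry]
  split_ifs with h
  · exact (natDegree_monomial_le _).trans (wexp_sub_mul_le_rowExp k δ i _ h.1 h.2)
  · simp

variable {k δ d}

/-- A Leibniz term is a monomial or zero. Equality in the rearrangement inequality singles out the
permutations whose monomial has the exponent of the diagonal. -/
theorem coeff_prod_polyEntry (hd : Monotone d)
    (hv : ∀ i : Fin M, k * d i ≤ i ∧ i < k * d i + δ + k)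
    (hk : 0 < k) (σ : Equiv.Perm (Fin M)) :
    (∏ i : Fin M, polyEntry k δ i (d (σ i)) (x (σ i))).coeff
        (∑ i : Fin M, wexp k (i - k * d i))
      = if d ∘ σ = d then ∏ i : Fin M, x (σ i) ^ (i - k * d i) else 0 := by
  by_cases hσ : ∀ i : Fin M, k * d (σ i) ≤ i ∧ i < k * d (σ i) + δ + k
  · have h1 : ∏ i : Fin M, polyEntry k δ i (d (σ i)) (x (σ i))
        = monomial (∑ i : Fin M, wexp k (i - k * d (σ i)))
          (∏ i : Fin M, x (σ i) ^ (i - k * d (σ i))) := by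
      rw [← C_mul_X_pow_eq_monomial, map_prod, ← Finset.prod_pow_eq_pow_sum,
        ← Finset.prod_mul_distrib]
      exact Finset.prod_congr rfl fun i _ => by
        rw [polyEntry, if_pos (hσ i), C_mul_X_pow_eq_monomial]
    -- Exponent of the `τ`-term plus `∑ i * d (τ i)` does not depend on `τ`.
    have key : ∀ τ : Equiv.Perm (Fin M), (∀ i : Fin M, k * d (τ i) ≤ i) →
        ∑ i : Fin M, wexp k (i - k * d (τ i)) + ∑ i : Fin M, (i : ℕ) * d (τ i)
          = ∑ i : Fin M, wexp k i + ∑ i : Fin M, k * (d i + 1).choose 2 := by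
      intro τ hτ
      rw [← Equiv.sum_comp τ fun i => k * (d i + 1).choose 2, ← Finset.sum_add_distrib,
        ← Finset.sum_add_distrib]
      exact Finset.sum_congr rfl fun i _ => wexp_sub_mul k _ _ hk (hτ i)
    have k1 := key σ fun i => (hσ i).1
    have k2 := key 1 fun i => (hv i).1
    simp only [Equiv.Perm.coe_one, id_eq] at k2
    have hmv : Monovary (fun i : Fin M => (i : ℕ)) d := fun i j hij =>
      (hd.reflect_lt hij).le
    have hiff := hmv.sum_mul_comp_perm_eq_sum_mul_iff (σ := σ)
    rw [h1, coeff_monomial]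
    by_cases h : d ∘ σ = d
    · have h' : ∀ i, d (σ i) = d i := fun i => congrFun h i
      simp only [h', if_true, h]
    · rw [if_neg h, if_neg]
      intro heq
      apply h
      have hm := hiff.1 (by omega)
      have hmono : Monotone (d ∘ σ) := by
        intro i j hij
        by_contra hlt
        have h3 : j ≤ i := by simpa using hm (not_le.1 hlt)
        rw [le_antisymm hij h3] at hlt
        exact hlt le_rfl
      -- Two sorted rearrangements of the same tuple coincide.
      have := Tuple.unique_monotone (f := d) (σ := σ) (τ := 1) hmono (by simpa using hd)
      simpa using this
  · rw [if_neg, ← coeff_zero (∑ i : Fin M, wexp k (i - k * d i))]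
    · push Not at hσ
      obtain ⟨i, hi⟩ := hσ
      congr 1
      refine Finset.prod_eq_zero (Finset.mem_univ i) (if_neg ?_)
      rintro ⟨h1, h2⟩
      exact absurd h2 (not_lt.2 (hi h1))
    · intro h
      refine hσ fun i => ?_
      rw [show d (σ i) = d i from congrFun h i]
      exact hv i

theorem coeff_det_polyEntry (hd : Monotone d)
    (hv : ∀ i : Fin M, k * d i ≤ i ∧ i < k * d i + δ + k)
    (hk : 0 < k) :
    (Matrix.of fun i c : Fin M => polyEntry k δ i (d c) (x c)).det.coeff
        (∑ i : Fin M, wexp k (i - k * d i))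
      = (Matrix.of fun i c : Fin M =>
          if d c = d i then x c ^ ((i : ℕ) - k * d i) else 0).det := by
  rw [← det_transpose, ← det_transpose (Matrix.of fun i c : Fin M => ite _ _ _), det_apply',
    det_apply', finsetSum_coeff]
  refine Finset.sum_congr rfl fun σ _ => ?_
  simp only [transpose_apply, of_apply]
  rw [← C_eq_intCast, coeff_C_mul, coeff_prod_polyEntry x hd hv hk σ]
  congr 1
  split_ifs with h
  · exact Finset.prod_congr rfl fun i _ => (if_pos (congrFun h i)).symm
  · obtain ⟨i, hi⟩ := Function.ne_iff.1 h
    exact (Finset.prod_eq_zero (Finset.mem_univ i) (if_neg hi)).symm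

/-- The coefficient at the diagonal exponent is block diagonal. A left kernel vector is killed one
block at a time, each block being a Vandermonde system with consecutive exponents. -/
theorem det_polyEntry_ne_zero (hd : Monotone d)
    (hv : ∀ i : Fin M, k * d i ≤ i ∧ i < k * d i + δ + k)
    (hk : 0 < k) (hx0 : ∀ i, x i ≠ 0)
    (hx : ∀ i j, d i = d j → x i = x j → i = j) :
    (Matrix.of fun i c : Fin M => polyEntry k δ i (d c) (x c)).det ≠ 0 := by
  intro h0
  have h1 := coeff_det_polyEntry x hd hv hk
  rw [h0, coeff_zero] at h1
  obtain ⟨w, hw0, hw⟩ := exists_vecMul_eq_zero_iff.2 h1.symm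
  refine hw0 (funext fun i => ?_)
  set s := Finset.univ.filter fun j => d j = d i with hs
  have his : i ∈ s := by simp [hs]
  have hne : s.Nonempty := ⟨i, his⟩
  have hmem : ∀ {j}, j ∈ s ↔ d j = d i := by simp [hs]
  -- As `d` is monotone, the block `s` is an interval, so its exponents fill a window of length
  -- `s.card`.
  have hb : ∀ j ∈ s, (j : ℕ) < s.min' hne + s.card := by
    intro j hj
    have hsub : Finset.Icc (s.min' hne) j ⊆ s := by
      intro l hl
      rw [Finset.mem_Icc] at hl
      have h2 := hmem.1 (s.min'_mem hne)
      have h3 := hmem.1 hj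
      exact hmem.2 (le_antisymm (h3 ▸ hd hl.2) (h2 ▸ hd hl.1))
    have := Finset.card_le_card hsub
    rw [Fin.card_Icc] at this
    omega
  have hvs : ∀ j ∈ s, k * d i ≤ j := fun j hj => by
    rw [← hmem.1 hj]; exact (hv j).1
  refine eq_zero_of_sum_mul_pow_eq_zero s (fun j => (j : ℕ) - k * d i)
    ((s.min' hne : Fin M) - k * d i) ?_ ?_ ?_ x ?_ (fun j _ => hx0 j) w ?_ i his
  · intro a ha b hb' hab
    have h1 := hvs a ha
    have h2 := hvs b hb'
    simp only at hab
    ext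
    omega
  · intro j hj
    have : (s.min' hne : ℕ) ≤ j := s.min'_le j hj
    omega
  · intro j hj
    have h1 := hb j hj
    have h2 := hvs _ (s.min'_mem hne)
    have h3 := hvs j hj
    omega
  · intro a ha b hb' hab
    exact hx a b ((hmem.1 ha).trans (hmem.1 hb').symm) hab
  · intro c hc
    rw [← show _ = (0 : F) from congrFun hw c, vecMul, dotProduct, Finset.sum_filter]
    refine Finset.sum_congr rfl fun j _ => ?_
    rw [of_apply, hmem.1 hc]
    by_cases h : d j = d i
    · rw [if_pos h, if_pos h.symm, h]
    · rw [if_neg h, if_neg (Ne.symm h), mul_zero]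

end Det

/-- `γ` is not a root of a nonzero polynomial of degree at most `D` over `F`. -/
def AvoidsDegree (F : Type*) {K : Type*} [Field F] [Field K] [Algebra F K] (γ : K) (D : ℕ) :
    Prop :=
  ∀ p : F[X], p ≠ 0 → p.natDegree ≤ D → aeval γ p ≠ 0

theorem AvoidsDegree.pow_ne_zero {F K : Type*} [Field F] [Field K] [Algebra F K] {γ : K} {D : ℕ}
    (h : AvoidsDegree F γ D) {e : ℕ} (he : e ≤ D) : γ ^ e ≠ 0 := by
  simpa using h (X ^ e) (_root_.pow_ne_zero _ X_ne_zero) (by simpa using he)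

/-- The irreducible `f` is associated to the minimal polynomial of `γ`, so that polynomial has the
degree of `f`. -/
theorem avoidsDegree_of_irreducible {F K : Type*} [Field F] [Field K] [Algebra F K] {γ : K}
    {f : F[X]} (hf : Irreducible f) (h0 : aeval γ f = 0) {D : ℕ} (hD : D < f.natDegree) :
    AvoidsDegree F γ D := by
  intro p hp hpd h
  have hint : IsIntegral F γ := IsAlgebraic.isIntegral ⟨f, hf.ne_zero, h0⟩
  obtain ⟨c, hc⟩ := minpoly.dvd F γ h0
  have hu : IsUnit c := (hf.isUnit_or_isUnit hc).resolve_left (minpoly.not_isUnit F γ)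
  have h1 : f.natDegree = (minpoly F γ).natDegree := by
    have hc0 : c ≠ 0 := hu.ne_zero
    rw [hc, natDegree_mul (minpoly.ne_zero hint) hc0, natDegree_eq_zero_of_isUnit hu, add_zero]
  have h2 := natDegree_le_of_dvd (minpoly.dvd F γ h) hp
  omega

theorem det_entry_ne_zero {F K : Type*} [Field F] [Field K] [Algebra F K] {M k δ p : ℕ} {γ : K}
    (hγ : AvoidsDegree F γ (degBound k δ p)) (hk : 0 < k) (hM : M ≤ δ + k * p)
    {d : Fin M → ℕ} {x : Fin M → F} (hd : Monotone d)
    (hv : ∀ i : Fin M, k * d i ≤ i ∧ i < k * d i + δ + k) (hx0 : ∀ i, x i ≠ 0)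
    (hx : ∀ i j, d i = d j → x i = x j → i = j) :
    (Matrix.of fun i c : Fin M => entry k δ γ i (d c) (algebraMap F K (x c))).det ≠ 0 := by
  have h := hγ _ (det_polyEntry_ne_zero x hd hv hk hx0 hx)
    (natDegree_det_polyEntry_le k δ d x p hk hM)
  rw [← AlgHom.coe_toRingHom, RingHom.map_det] at h
  convert h using 2
  ext i c
  simp only [of_apply, RingHom.mapMatrix_apply, map_apply]
  exact (aeval_polyEntry k δ γ i (d c) (x c)).symm

/-! ## Sliding matrices and weights -/

theorem sum_range_mul {A : Type*} [AddCommMonoid A] (f : ℕ → A) (a k : ℕ) :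
    ∑ q ∈ Finset.range (a * k), f q = ∑ i ∈ Finset.range a, ∑ c : Fin k, f (i * k + c) := by
  induction a with
  | zero => simp
  | succ a ih =>
    rw [Nat.succ_mul, Finset.sum_range_add, ih, Finset.sum_range_succ,
      Fin.sum_univ_eq_sum_range fun c => f (a * k + c)]

theorem ofNat_mul_add {n : ℕ} [NeZero n] (i : ℕ) (c : Fin n) : Fin.ofNat n (i * n + c) = c := by
  ext
  rw [Fin.val_ofNat, Nat.mul_add_mod', Nat.mod_eq_of_lt c.2]

theorem mul_add_div_fin {n : ℕ} (i : ℕ) (c : Fin n) : (i * n + c) / n = i := by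
  rw [Nat.mul_comm, Nat.mul_add_div c.pos, Nat.div_eq_of_lt c.2, add_zero]

theorem card_filter_range_mul {n : ℕ} [NeZero n] (P : ℕ → Fin n → Prop)
    [∀ i c, Decidable (P i c)] (a : ℕ) :
    ((Finset.range (a * n)).filter fun q => P (q / n) (Fin.ofNat n q)).card
      = ∑ i ∈ Finset.range a, (Finset.univ.filter (P i)).card := by
  simp only [Finset.card_filter]
  rw [sum_range_mul]
  simp only [ofNat_mul_add, mul_add_div_fin]

theorem sum_orderEmbOfFin {A : Type*} [AddCommMonoid A] {M : ℕ} (S : Finset ℕ) (hc : S.card = M)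
    (f : ℕ → A) : ∑ i : Fin M, f (S.orderEmbOfFin hc i) = ∑ q ∈ S, f q := by
  conv_rhs => rw [← Finset.map_orderEmbOfFin_univ S hc]
  rw [Finset.sum_map]
  rfl

theorem card_filter_lt_le {M : ℕ} (S : Finset ℕ) (hc : S.card = M) (i : Fin M) (a : ℕ)
    (h : a ≤ S.orderEmbOfFin hc i) : (S.filter (· < a)).card ≤ i := by
  have hsub : S.filter (· < a) ⊆ (Finset.Iio i).map (S.orderEmbOfFin hc).toEmbedding := by
    intro q hq
    obtain ⟨hqS, hqa⟩ := Finset.mem_filter.1 hq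
    rw [← Finset.map_orderEmbOfFin_univ S hc] at hqS
    obtain ⟨c, -, rfl⟩ := Finset.mem_map.1 hqS
    refine Finset.mem_map.2 ⟨c, Finset.mem_Iio.2 ?_, rfl⟩
    exact (S.orderEmbOfFin hc).lt_iff_lt.1 (lt_of_lt_of_le hqa h)
  simpa using Finset.card_le_card hsub

theorem le_orderEmbOfFin {M : ℕ} (S : Finset ℕ) (hc : S.card = M) (i : Fin M) :
    (i : ℕ) ≤ S.orderEmbOfFin hc i := by
  have hsub : (Finset.Iio i).map (S.orderEmbOfFin hc).toEmbedding
      ⊆ Finset.range (S.orderEmbOfFin hc i) := by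
    intro q hq
    obtain ⟨c, hci, rfl⟩ := Finset.mem_map.1 hq
    exact Finset.mem_range.2 ((S.orderEmbOfFin hc).lt_iff_lt.2 (Finset.mem_Iio.1 hci))
  simpa using Finset.card_le_card hsub

theorem eq_of_div_eq_of_ofNat_eq {n : ℕ} [NeZero n] {a b : ℕ} (h1 : a / n = b / n)
    (h2 : Fin.ofNat n a = Fin.ofNat n b) : a = b := by
  have h3 : a % n = b % n := by simpa [Fin.ext_iff] using h2
  rw [← Nat.div_add_mod a n, ← Nat.div_add_mod b n, h1, h3]

section Sliding

variable {F K : Type*} [Field F] [Field K] [Algebra F K] {n k r δ : ℕ} [NeZero n] {γ : K}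
  {α : Fin n → F}

/-- The count condition gives `k * d ≤ i` for the `i`-th chosen column, lying in block `d`. The
other edge of the window follows from `i < (d + 1) * n` for early blocks and from the bound on `j`
for late ones. -/
theorem det_sliding_ne_zero (hn : k + r = n) (hk : 0 < k) (hr : 0 < r)
    (hγ : AvoidsDegree F γ (degBound k δ (δ / r + 1)))
    (hα : Function.Injective α) (hα0 : ∀ i, α i ≠ 0) {j : ℕ} (hj : j ≤ δ / k + δ / r)
    {S : Finset ℕ} (hc : S.card = (j + 1) * k) (hS : S ⊆ Finset.range ((j + 1) * n))
    (hcount : ∀ s ≤ j, s * k ≤ (S.filter (· < s * n)).card) :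
    (Matrix.of fun i c : Fin ((j + 1) * k) =>
      entry k δ γ i (S.orderEmbOfFin hc c / n)
        (algebraMap F K (α (Fin.ofNat n (S.orderEmbOfFin hc c))))).det ≠ 0 := by
  have hn0 : 0 < n := by omega
  have h1 := Nat.div_mul_le_self δ k
  refine det_entry_ne_zero (d := fun c => S.orderEmbOfFin hc c / n)
    (x := fun c => α (Fin.ofNat n (S.orderEmbOfFin hc c))) hγ hk ?_ ?_ ?_ (fun _ => hα0 _) ?_
  · have h2 : (j + 1) * k ≤ (δ / k + δ / r + 1) * k := Nat.mul_le_mul_right _ (by omega)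
    have h3 : (δ / k + δ / r + 1) * k = δ / k * k + k * (δ / r + 1) := by ring
    omega
  · exact fun a b hab => Nat.div_le_div_right ((S.orderEmbOfFin hc).monotone hab)
  · intro i
    set d := S.orderEmbOfFin hc i / n with hd
    have hd1 : d * n ≤ S.orderEmbOfFin hc i := Nat.div_mul_le_self _ _
    have hd2 : S.orderEmbOfFin hc i < (d + 1) * n := 
      (Nat.div_lt_iff_lt_mul hn0).1 (Nat.lt_succ_self _)
    have hdj : d ≤ j := by
      have h2 := Finset.mem_range.1 (hS (S.orderEmbOfFin_mem hc i))
      have h3 : d * n < (j + 1) * n := hd1.trans_lt h2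
      exact Nat.lt_succ_iff.1 (Nat.lt_of_mul_lt_mul_right h3)
    refine ⟨?_, ?_⟩
    · have := (hcount d hdj).trans (card_filter_lt_le S hc i _ hd1)
      rwa [mul_comm]
    · have hle := le_orderEmbOfFin S hc i
      -- Early block: `i < (d + 1) * (k + r) ≤ k * d + k + δ`. Otherwise `d ≥ δ / r`, so `j - d ≤ δ
      -- / k`, and `i < (j + 1) * k` suffices.
      by_cases h : (d + 1) * r ≤ δ
      · have h2 : (d + 1) * n = (d + 1) * r + k * d + k := by rw [← hn]; ring
        omega
      · have h2 : δ / r ≤ d := by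
          have : δ < (d + 1) * r := by omega
          exact Nat.lt_succ_iff.1 ((Nat.div_lt_iff_lt_mul hr).2 this)
        obtain ⟨c, hc'⟩ : ∃ c, j = d + c := ⟨j - d, by omega⟩
        have h3 : c * k ≤ δ / k * k := Nat.mul_le_mul_right _ (by omega)
        have h4 : (j + 1) * k = k * d + c * k + k := by rw [hc']; ring
        have := i.2
        omega
  · intro a b hab hx
    exact (S.orderEmbOfFin hc).injective (eq_of_div_eq_of_ofNat_eq hab (hα hx))

theorem eq_zero_of_sliding_mulVec (hn : k + r = n) (hk : 0 < k) (hr : 0 < r)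
    (hγ : AvoidsDegree F γ (degBound k δ (δ / r + 1)))
    (hα : Function.Injective α) (hα0 : ∀ i, α i ≠ 0) {j : ℕ} (hj : j ≤ δ / k + δ / r)
    {S : Finset ℕ} (hc : S.card = (j + 1) * k) (hS : S ⊆ Finset.range ((j + 1) * n))
    (hcount : ∀ s ≤ j, s * k ≤ (S.filter (· < s * n)).card) (y : ℕ → K)
    (hy : ∀ ρ < (j + 1) * k,
      ∑ q ∈ S, entry k δ γ ρ (q / n) (algebraMap F K (α (Fin.ofNat n q))) * y q = 0) :
    ∀ q ∈ S, y q = 0 := by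
  have h := det_sliding_ne_zero hn hk hr hγ hα hα0 hj hc hS hcount
  have h1 := eq_zero_of_mulVec_eq_zero h (v := fun c => y (S.orderEmbOfFin hc c)) (by
    ext i
    have := hy i i.2
    rw [← sum_orderEmbOfFin S hc] at this
    exact this)
  intro q hq
  rw [← Finset.map_orderEmbOfFin_univ S hc] at hq
  obtain ⟨c, -, rfl⟩ := Finset.mem_map.1 hq
  exact congrFun h1 c

theorem eq_zero_of_sliding_vecMul (hn : k + r = n) (hk : 0 < k) (hr : 0 < r)
    (hγ : AvoidsDegree F γ (degBound k δ (δ / r + 1)))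
    (hα : Function.Injective α) (hα0 : ∀ i, α i ≠ 0) {j : ℕ} (hj : j ≤ δ / k + δ / r)
    {S : Finset ℕ} (hc : S.card = (j + 1) * k) (hS : S ⊆ Finset.range ((j + 1) * n))
    (hcount : ∀ s ≤ j, s * k ≤ (S.filter (· < s * n)).card) (w : ℕ → K)
    (hw : ∀ q ∈ S, ∑ ρ ∈ Finset.range ((j + 1) * k),
      w ρ * entry k δ γ ρ (q / n) (algebraMap F K (α (Fin.ofNat n q))) = 0) :
    ∀ ρ < (j + 1) * k, w ρ = 0 := by
  have h := det_sliding_ne_zero hn hk hr hγ hα hα0 hj hc hS hcount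
  have h1 := eq_zero_of_vecMul_eq_zero h (v := fun i => w i) (by
    ext c
    have := hw _ (S.orderEmbOfFin_mem hc c)
    rw [← Fin.sum_univ_eq_sum_range
      (fun ρ => w ρ * entry k δ γ ρ (S.orderEmbOfFin hc c / n) _)] at this
    exact this)
  exact fun ρ hρ => congrFun h1 ⟨ρ, hρ⟩

end Sliding

/-! ### Codes and parity checks in terms of sliding entries -/

section Coefficients

variable {K : Type*} [Field K] {n k δ : ℕ} (γ : K) (x : Fin n → K)

theorem entry_of_lt {ρ d : ℕ} (h : ρ < k * d) (y : K) : entry k δ γ ρ d y = 0 :=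
  if_neg fun h' => by omega

theorem entry_of_ge {ρ d : ℕ} (h : k * d + δ + k ≤ ρ) (y : K) : entry k δ γ ρ d y = 0 :=
  if_neg fun h' => by omega

theorem entry_add (ρ d e : ℕ) (y : K) :
    entry k δ γ (k * e + ρ) (e + d) y = entry k δ γ ρ d y := by
  have h : k * e + ρ - (k * e + k * d) = ρ - k * d := by omega
  rw [entry, entry, mul_add, h]
  refine if_congr ?_ rfl rfl
  omega

theorem le_wrsMemory_mul (hk : 0 < k) : δ ≤ wrsMemory k δ * k := by
  have h := Nat.le_ceil ((δ : ℚ) / k)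
  rw [div_le_iff₀ (by exact_mod_cast hk)] at h
  exact_mod_cast h

theorem wrsMemory_pred_mul_lt (hk : 0 < k) (hδ : 0 < δ) : (wrsMemory k δ - 1) * k < δ := by
  have hk' : (0 : ℚ) < k := by exact_mod_cast hk
  have h0 : (0 : ℚ) ≤ (δ : ℚ) / k := by positivity
  have h := Nat.ceil_lt_add_one h0
  have h1 : 0 < wrsMemory k δ := Nat.ceil_pos.2 (by positivity)
  have h2 : ((wrsMemory k δ - 1 : ℕ) : ℚ) < (δ : ℚ) / k := by
    rw [Nat.cast_sub h1, Nat.cast_one]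
    exact sub_lt_iff_lt_add.2 h
  rw [lt_div_iff₀ hk'] at h2
  exact_mod_cast h2

/-- The single cutoff `e < δ + k` accounts for both `M_i` and the truncated `N_{m,t}`: at `i = m` it
reads `j < δ - (m - 1) * k = t`. -/
theorem coeff_wrsMatrix (hk : 0 < k) (hδ : 0 < δ) (i : ℕ) (a : Fin k) (c : Fin n) :
    (wrsMatrix k δ γ x a c).coeff i = entry k δ γ (i * k + (a.rev : ℕ)) 0 (x c) := by
  have h1 := le_wrsMemory_mul (δ := δ) hk
  have h2 := wrsMemory_pred_mul_lt hk hδ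
  have ha := a.rev.2
  have hw : γ ^ wexp k (i * k + (a.rev : ℕ)) * x c ^ (i * k + (a.rev : ℕ))
      = wrsM k γ x i a c := by
    rw [wexp_mul_add k i _ ha, wrsM, of_apply]
  simp only [wrsMatrix, of_apply, finsetSum_coeff, coeff_C_mul, coeff_X_pow, mul_ite, mul_one,
    mul_zero, Finset.sum_ite_eq, Finset.mem_range, entry, Nat.zero_le, true_and, zero_add,
    Nat.sub_zero, hw]
  set m := wrsMemory k δ with hm
  have hmpos : 0 < m := by
    rcases Nat.eq_zero_or_pos m with h | h
    · rw [h] at h1; omega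
    · exact h
  clear_value m
  obtain ⟨m', rfl⟩ : ∃ m', m = m' + 1 := ⟨m - 1, by omega⟩
  rw [Nat.add_sub_cancel] at h2
  have hsucc : (m' + 1) * k = m' * k + k := by ring
  rcases lt_trichotomy i (m' + 1) with h | h | h
  · have h3 : i * k ≤ m' * k := Nat.mul_le_mul_right _ (by omega)
    rw [if_pos (by omega), wrsCoeff, ← hm, if_pos h, if_pos (by omega)]
  · rw [if_pos (by omega), wrsCoeff, ← hm, if_neg (by omega), wrsN, of_apply, h,
      Nat.add_sub_cancel]
    refine if_congr ?_ rfl rfl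
    omega
  · have h3 : (m' + 2) * k ≤ i * k := Nat.mul_le_mul_right _ (by omega)
    have h4 : (m' + 2) * k = m' * k + k + k := by ring
    rw [if_neg (by omega), if_neg (by omega)]

/-- Time runs backwards: row block `b` carries `u_{j-b}` and column block `d` carries `v_{j-d}`, so
the coefficient between them is `G_{b-d}`. -/
theorem coeff_vecMul_wrsMatrix [NeZero k] (hδ : 0 < δ) (u : Fin k → K[X]) (c : Fin n)
    {j d : ℕ} (hd : d ≤ j) :
    ((u ᵥ* wrsMatrix k δ γ x) c).coeff (j - d)
      = ∑ ρ ∈ Finset.range ((j + 1) * k),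
          (u (Fin.ofNat k ρ).rev).coeff (j - ρ / k) * entry k δ γ ρ d (x c) := by
  have hk := NeZero.pos k
  rw [sum_range_mul]
  simp only [ofNat_mul_add, mul_add_div_fin]
  obtain ⟨e, rfl⟩ := Nat.exists_eq_add_of_le hd
  rw [add_assoc, Finset.sum_range_add, Finset.sum_eq_zero, zero_add]
  · rw [vecMul, dotProduct, finsetSum_coeff, Nat.add_sub_cancel_left, Finset.sum_comm]
    rw [← Equiv.sum_comp Fin.revPerm]
    refine Finset.sum_congr rfl fun a _ => ?_
    rw [Fin.revPerm_apply, mul_comm, coeff_mul,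
      Finset.Nat.sum_antidiagonal_eq_sum_range_succ
        (fun p q => (wrsMatrix k δ γ x a.rev c).coeff p * (u a.rev).coeff q)]
    refine Finset.sum_congr rfl fun b _ => ?_
    have h1 : (d + b) * k + (a : ℕ) = k * d + (b * k + a) := by ring
    have h2 := entry_add (k := k) (δ := δ) γ (b * k + a) 0 d (x c)
    rw [coeff_wrsMatrix γ x hk hδ, Fin.rev_rev, mul_comm, h1, ← h2, add_zero]
    congr 2
    omega
  · intro b hb
    refine Finset.sum_eq_zero fun a _ => ?_
    rw [entry_of_lt, mul_zero]
    have h1 := Finset.mem_range.1 hb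
    have h2 : (b + 1) * k ≤ d * k := Nat.mul_le_mul_right _ h1
    have := a.2
    rw [mul_comm k d]
    linarith

/-- Here column block `d` carries `v_d`, without time reversal. Blocks beyond `l` contribute
nothing, so one range serves all `l ≤ T`. -/
theorem coeff_mulVec_wrsMatrix [NeZero n] (hk : 0 < k) (hδ : 0 < δ) (v : Fin n → K[X])
    (a : Fin k) {l T : ℕ} (hl : l ≤ T) :
    ((wrsMatrix k δ γ x *ᵥ v) a).coeff l
      = ∑ q ∈ Finset.range ((T + 1) * n),
          entry k δ γ (l * k + (a.rev : ℕ)) (q / n) (x (Fin.ofNat n q))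
            * (v (Fin.ofNat n q)).coeff (q / n) := by
  have ha := a.rev.2
  rw [sum_range_mul]
  simp only [ofNat_mul_add, mul_add_div_fin]
  obtain ⟨e, rfl⟩ := Nat.exists_eq_add_of_le hl
  rw [show l + e + 1 = (l + 1) + e by ring, Finset.sum_range_add _ (l + 1) e]
  conv_rhs => rw [add_comm]
  rw [Finset.sum_eq_zero, zero_add]
  · rw [mulVec, dotProduct, finsetSum_coeff, Finset.sum_comm]
    refine Finset.sum_congr rfl fun c _ => ?_
    rw [mul_comm, coeff_mul, Finset.Nat.sum_antidiagonal_eq_sum_range_succ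
        (fun p q => (v c).coeff p * (wrsMatrix k δ γ x a c).coeff q)]
    refine Finset.sum_congr rfl fun b hb => ?_
    obtain ⟨f, rfl⟩ := Nat.exists_eq_add_of_le (Nat.lt_succ_iff.1 (Finset.mem_range.1 hb))
    have h1 : (b + f) * k + (a.rev : ℕ) = k * b + (f * k + a.rev) := by ring
    have h2 := entry_add (k := k) (δ := δ) γ (f * k + a.rev) 0 b (x c)
    rw [coeff_wrsMatrix γ x hk hδ, Nat.add_sub_cancel_left, mul_comm, h1, ← h2, add_zero]
  · intro b _
    refine Finset.sum_eq_zero fun c _ => ?_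
    rw [entry_of_lt, zero_mul]
    have : k * (l + 1 + b) = l * k + k + k * b := by ring
    have := Nat.zero_le (k * b)
    omega

end Coefficients

/-! ### Truncated weights and column distances -/

section Weights

variable {K : Type*} [Field K] {n : ℕ}

open Classical in
theorem truncWeight_eq [NeZero n] (v : Fin n → K[X]) (j : ℕ) :
    truncWeight j v = ((Finset.range ((j + 1) * n)).filter fun q =>
      (v (Fin.ofNat n q)).coeff (q / n) ≠ 0).card := by
  rw [card_filter_range_mul fun i c => (v c).coeff i ≠ 0]
  refine Finset.sum_congr rfl fun i _ => ?_
  rw [hammingNorm]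
  rfl

theorem hammingNorm_le_sub [DecidableEq K] (y : Fin n → K) (T : Finset (Fin n))
    (h : ∀ c ∈ T, y c = 0) : hammingNorm y ≤ n - T.card := by
  have : (Finset.univ.filter fun c => y c ≠ 0) ⊆ Tᶜ := by
    intro c hc
    rw [Finset.mem_compl]
    exact fun hcT => (Finset.mem_filter.1 hc).2 (h c hcT)
  have h1 := Finset.card_le_card this
  rwa [Finset.card_compl, Fintype.card_fin] at h1

theorem truncWeight_le (v : Fin n → K[X]) (r j : ℕ) (T₀ T : Finset (Fin n))
    (hT₀ : n ≤ T₀.card + r + 1) (hT : n ≤ T.card + r)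
    (h0 : ∀ c ∈ T₀, (v c).coeff 0 = 0) (h : ∀ c ∈ T, ∀ i, 0 < i → i ≤ j → (v c).coeff i = 0) :
    truncWeight j v ≤ r * (j + 1) + 1 := by
  classical
  rw [truncWeight, Finset.sum_range_succ']
  have h1 := hammingNorm_le_sub (coeffVec v 0) T₀ h0
  have h2 : ∀ i ∈ Finset.range j, hammingNorm (coeffVec v (i + 1)) ≤ r := fun i hi => by
    have := hammingNorm_le_sub (coeffVec v (i + 1)) T
      fun c hc => h c hc (i + 1) (by omega) (Finset.mem_range.1 hi)
    omega
  have h3 := Finset.sum_le_card_nsmul _ _ _ h2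
  rw [Finset.card_range, smul_eq_mul] at h3
  have h4 : r * (j + 1) = j * r + r := by ring
  have h5 : hammingNorm (coeffVec v 0) ≤ r + 1 := by omega
  rw [h4, add_assoc]
  convert add_le_add h3 h5 using 2

theorem columnDistance_eq {C : Submodule K[X] (Fin n → K[X])} {j N : ℕ}
    (hl : ∀ v ∈ C, coeffVec v 0 ≠ 0 → N ≤ truncWeight j v)
    (hu : ∃ v ∈ C, coeffVec v 0 ≠ 0 ∧ truncWeight j v ≤ N) : columnDistance C j = N := by
  obtain ⟨v, hv, hv0, hvN⟩ := hu
  rw [columnDistance]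
  apply le_antisymm
  · refine le_trans (Nat.sInf_le ?_) hvN
    exact ⟨v, hv, hv0, rfl⟩
  · apply le_csInf
    · exact ⟨_, v, hv, hv0, rfl⟩
    · rintro w ⟨v', hv', hv0', rfl⟩
      exact hl v' hv' hv0'

end Weights

/-! ## Degrees of minors -/

theorem natDegree_prod_le_sum_and_coeff {R ι : Type*} [CommRing R] (s : Finset ι) (f : ι → R[X])
    (ν : ι → ℕ) (h : ∀ i ∈ s, (f i).natDegree ≤ ν i) :
    (∏ i ∈ s, f i).natDegree ≤ ∑ i ∈ s, ν i ∧
      (∏ i ∈ s, f i).coeff (∑ i ∈ s, ν i) = ∏ i ∈ s, (f i).coeff (ν i) := by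
  classical
  induction s using Finset.induction_on with
  | empty => simp
  | insert a s ha ih =>
    obtain ⟨h1, h2⟩ := ih fun i hi => h i (Finset.mem_insert_of_mem hi)
    have h3 := h a (Finset.mem_insert_self a s)
    rw [Finset.prod_insert ha, Finset.sum_insert ha, Finset.prod_insert ha, ← h2]
    exact ⟨natDegree_mul_le_of_le h3 h1, coeff_mul_add_eq_of_natDegree_le h3 h1⟩

theorem natDegree_det_le_and_coeff {R ι : Type*} [CommRing R] [Fintype ι] [DecidableEq ι]
    (A : Matrix ι ι R[X]) (ν : ι → ℕ) (h : ∀ i j, (A i j).natDegree ≤ ν i) :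
    A.det.natDegree ≤ ∑ i, ν i ∧
      A.det.coeff (∑ i, ν i) = (Matrix.of fun i j => (A i j).coeff (ν i)).det := by
  rw [← det_transpose, ← det_transpose (Matrix.of _), det_apply', det_apply', finsetSum_coeff]
  refine ⟨natDegree_sum_le_of_forall_le _ _ fun σ _ => ?_, Finset.sum_congr rfl fun σ _ => ?_⟩
  · refine natDegree_mul_le.trans ?_
    rw [natDegree_intCast, zero_add]
    exact (natDegree_prod_le_sum_and_coeff _ _ ν fun i _ => h i (σ i)).1
  · rw [← C_eq_intCast, coeff_C_mul]
    congr 1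
    exact (natDegree_prod_le_sum_and_coeff _ _ ν fun i _ => h i (σ i)).2

/-! ### Leading and constant coefficients of the minors of `G(z)` -/

section WRSMatrix

variable {F K : Type*} [Field F] [Field K] [Algebra F K] {n k p δ : ℕ} {γ : K} {α : Fin n → F}

theorem natDegree_wrsMatrix_le (hk : 0 < k) (hδ : 0 < δ) (x : Fin n → K) (a : Fin k) (c : Fin n) :
    (wrsMatrix k δ γ x a c).natDegree ≤ (δ + a) / k := by
  refine natDegree_le_iff_coeff_eq_zero.2 fun i hi => ?_
  rw [coeff_wrsMatrix γ x hk hδ, entry_of_ge]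
  have h1 := (Nat.div_lt_iff_lt_mul hk).1 hi
  have h2 := Fin.val_rev a
  have := a.2
  omega

/-- In row `a`, the coefficient at the row degree bound `(δ + a) / k` has as its exponent of `x` the
integer in `[δ, δ + k)` with residue `a.rev`. Hence the `k` rows use `k` consecutive exponents. -/
theorem det_leadingCoeff_ne_zero (hk : 0 < k) (hδ : 0 < δ) (hp : 0 < p)
    (hγ : AvoidsDegree F γ (degBound k δ p)) (hα : Function.Injective α) (hα0 : ∀ i, α i ≠ 0)
    (c : Fin k → Fin n) (hc : Function.Injective c) :
    (Matrix.of fun a b : Fin k =>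
      (wrsMatrix k δ γ (fun i => algebraMap F K (α i)) a (c b)).coeff ((δ + a) / k)).det ≠ 0 := by
  have hinj := (algebraMap F K).injective
  have he : ∀ a : Fin k, δ ≤ (δ + a) / k * k + (a.rev : ℕ) ∧
      (δ + a) / k * k + (a.rev : ℕ) < δ + k := fun a => by
    have h1 := Nat.div_mul_le_self (δ + a) k
    have h2 := Nat.lt_div_mul_add (a := δ + a) hk
    have h3 := Fin.val_rev a
    have := a.2
    omega
  have h := det_pow_ne_zero (fun a : Fin k => (δ + a) / k * k + (a.rev : ℕ)) δ (by
      intro a b hab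
      simp only at hab
      have h1 : ((δ + a) / k * k + (a.rev : ℕ)) % k = ((δ + b) / k * k + (b.rev : ℕ)) % k := by
        rw [hab]
      rw [Nat.mul_add_mod', Nat.mul_add_mod', Nat.mod_eq_of_lt a.rev.2,
        Nat.mod_eq_of_lt b.rev.2] at h1
      exact Fin.rev_injective (Fin.ext h1))
    (fun a => (he a).1) (fun a => (he a).2) (fun b => algebraMap F K (α (c b)))
    (hinj.comp (hα.comp hc)) (fun b => (map_ne_zero_iff _ hinj).2 (hα0 _))
    (fun a => γ ^ wexp k ((δ + a) / k * k + (a.rev : ℕ)))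
    (fun a => hγ.pow_ne_zero (wexp_le_degBound k δ p _ hk hp (he a).2))
  convert h using 2
  ext a b
  rw [of_apply, of_apply, coeff_wrsMatrix γ _ hk hδ, entry, if_pos, mul_zero, Nat.sub_zero]
  have := (he a).2
  omega

theorem coeff_zero_det_wrsMatrix_ne_zero (hk : 0 < k) (hδ : 0 < δ) (hα : Function.Injective α)
    (hα0 : ∀ i, α i ≠ 0) (c : Fin k → Fin n) (hc : Function.Injective c) :
    ((wrsMatrix k δ γ fun i => algebraMap F K (α i)).submatrix id c).det.coeff 0 ≠ 0 := by
  have hinj := (algebraMap F K).injective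
  have h := det_pow_ne_zero (fun a : Fin k => (a.rev : ℕ)) 0
    (Fin.val_injective.comp Fin.rev_injective) (fun _ => Nat.zero_le _)
    (fun a => by simp only [zero_add]; exact a.rev.2) (fun b => algebraMap F K (α (c b)))
    (hinj.comp (hα.comp hc)) (fun b => (map_ne_zero_iff _ hinj).2 (hα0 _))
    (fun _ => 1) (fun _ => one_ne_zero)
  rw [← constantCoeff_apply, RingHom.map_det]
  convert h using 2
  ext a b
  rw [RingHom.mapMatrix_apply, map_apply, submatrix_apply, constantCoeff_apply, id,
    coeff_wrsMatrix γ _ hk hδ, of_apply, entry, if_pos, zero_mul, zero_add, mul_zero,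
    Nat.sub_zero, wexp_of_le, pow_zero]
  · exact a.rev.2.le
  · have := a.rev.2
    omega

/-- The minor has nonzero constant term, a Vandermonde determinant, so it is invertible modulo `z ^
(j + 1)`. -/
theorem exists_mul_det_wrsMatrix (hk : 0 < k) (hδ : 0 < δ) (hα : Function.Injective α)
    (hα0 : ∀ i, α i ≠ 0) (c : Fin k → Fin n) (hc : Function.Injective c) (j : ℕ) :
    ∃ f : K[X], ∀ i ≤ j,
      (f * ((wrsMatrix k δ γ fun i => algebraMap F K (α i)).submatrix id c).det).coeff i
        = if i = 0 then 1 else 0 := by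
  have h := coeff_zero_det_wrsMatrix_ne_zero (γ := γ) hk hδ hα hα0 c hc
  set D := ((wrsMatrix k δ γ fun i => algebraMap F K (α i)).submatrix id c).det
  have hcop : IsCoprime (X ^ (j + 1) : K[X]) D :=
    ((irreducible_X.coprime_iff_not_dvd).2 fun hd => h (X_dvd_iff.1 hd)).pow_left
  obtain ⟨a, b, hab⟩ := hcop
  refine ⟨b, fun i hi => ?_⟩
  rw [← eq_sub_iff_add_eq'] at hab
  rw [hab, coeff_sub, coeff_mul_X_pow', if_neg (by omega), sub_zero, coeff_one]

end WRSMatrix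

/-! ## WRS codes are MDP -/

section Code

variable {F K : Type*} [Field F] [Field K] [Algebra F K] {n k r δ : ℕ} {γ : K}
  {α : Fin n → F}

/-- The row degrees sum to `δ` and the leading row coefficients have only nonzero full size minors,
so every minor of `G(z)` has degree exactly `δ`. -/
theorem isConvCode_wrsCode (hkn : k < n) (hk : 0 < k) (hδ : 0 < δ)
    (hγ : AvoidsDegree F γ (degBound k δ (δ / r + 1)))
    (hα : Function.Injective α) (hα0 : ∀ i, α i ≠ 0) :
    IsConvCode k δ (wrsCode k δ γ fun i => algebraMap F K (α i)) := by
  set G := wrsMatrix k δ γ fun i => algebraMap F K (α i) with hG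
  have hsum : ∑ a : Fin k, (δ + (a : ℕ)) / k = δ := by
    rw [Fin.sum_univ_eq_sum_range fun a => (δ + a) / k, sum_add_div k δ hk]
  have hdeg : ∀ c : Fin k ↪o Fin n, (G.submatrix id c).det.natDegree ≤ δ ∧
      (G.submatrix id c).det.coeff δ ≠ 0 := fun c => by
    have h := natDegree_det_le_and_coeff (G.submatrix id c) (fun a => (δ + (a : ℕ)) / k)
      fun a b => natDegree_wrsMatrix_le hk hδ _ a (c b)
    rw [hsum] at h
    refine ⟨h.1, ?_⟩
    rw [h.2]
    exact det_leadingCoeff_ne_zero hk hδ (Nat.succ_pos _) hγ hα hα0 c c.injective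
  let c₀ : Fin k ↪o Fin n := Fin.castLEOrderEmb hkn.le
  refine ⟨G, ⟨?_, rfl⟩, le_antisymm (Finset.sup_le fun c _ => (hdeg c).1) ?_⟩
  · have hne : (G.submatrix id c₀).det ≠ 0 := fun h0 => (hdeg c₀).2 (by rw [h0, coeff_zero])
    have := linearIndependent_rows_of_det_ne_zero hne
    exact LinearIndependent.of_comp (LinearMap.funLeft K[X] K[X] c₀) this
  · exact (le_natDegree_of_ne_zero (hdeg c₀).2).trans
      (Finset.le_sup (f := fun c : Fin k ↪o Fin n => (G.submatrix id c).det.natDegree)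
        (Finset.mem_univ c₀))

/-- Encoding so that the first `k` positions agree with a unit vector modulo `z ^ (j + 1)` leaves
weight one there and at most `r` at each of the `j + 1` times. -/
theorem exists_mem_wrsCode_truncWeight_le (hn : k + r = n) (hk : 0 < k) (hδ : 0 < δ)
    (hα : Function.Injective α) (hα0 : ∀ i, α i ≠ 0) (j : ℕ) :
    ∃ v ∈ wrsCode k δ γ (fun i => algebraMap F K (α i)), coeffVec v 0 ≠ 0 ∧
      truncWeight j v ≤ r * (j + 1) + 1 := by
  classical
  set G := wrsMatrix k δ γ fun i => algebraMap F K (α i) with hG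
  let c₀ : Fin k ↪ Fin n := Fin.castLEEmb (by omega)
  obtain ⟨f, hf⟩ := exists_mul_det_wrsMatrix (γ := γ) hk hδ hα hα0 c₀ c₀.injective j
  rw [← hG] at hf
  let z : Fin k := ⟨0, hk⟩
  have hv : ∀ b, ∀ i ≤ j, (((f • (G.submatrix id c₀).adjugate z) ᵥ* G) (c₀ b)).coeff i
      = if b = z ∧ i = 0 then 1 else 0 := fun b i hi => by
    have h1 : (((G.submatrix id c₀).adjugate z) ᵥ* G) (c₀ b)
        = ((G.submatrix id c₀).adjugate * G.submatrix id c₀) z b := rfl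
    rw [smul_vecMul, Pi.smul_apply, h1, adjugate_mul, Matrix.smul_apply, smul_eq_mul, smul_eq_mul,
      one_apply]
    by_cases hb : b = z
    · simp only [hb, if_true, mul_one, true_and, hf i hi]
    · simp [hb, Ne.symm hb]
  refine ⟨(f • (G.submatrix id c₀).adjugate z) ᵥ* G, ⟨_, rfl⟩, ?_, ?_⟩
  · intro h0
    have h1 := hv z 0 (Nat.zero_le j)
    rw [if_pos ⟨rfl, rfl⟩] at h1
    exact one_ne_zero (h1.symm.trans (congrFun h0 (c₀ z)))
  · refine truncWeight_le _ r j ((Finset.univ.erase z).map c₀) (Finset.univ.map c₀) ?_ ?_ ?_ ?_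
    · rw [Finset.card_map, Finset.card_erase_of_mem (Finset.mem_univ z), Finset.card_univ,
        Fintype.card_fin]
      omega
    · rw [Finset.card_map, Finset.card_univ, Fintype.card_fin]
      omega
    · intro c hc
      obtain ⟨b, hb, rfl⟩ := Finset.mem_map.1 hc
      rw [hv b 0 (Nat.zero_le j), if_neg fun h => Finset.ne_of_mem_erase hb h.1]
    · intro c hc i hi0 hij
      obtain ⟨b, hb, rfl⟩ := Finset.mem_map.1 hc
      rw [hv b i hij, if_neg fun h => hi0.ne' h.2]

/-- Weight at most `r * (j + 1)` leaves at least `(j + 1) * k` zeros. On that many zero positions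
the sliding system determines `u_0, …, u_j` to be zero, hence `v_0 = 0`. -/
theorem le_truncWeight_of_mem_wrsCode [NeZero n] (hn : k + r = n) (hk : 0 < k) (hr : 0 < r)
    (hδ : 0 < δ) (hγ : AvoidsDegree F γ (degBound k δ (δ / r + 1)))
    (hα : Function.Injective α) (hα0 : ∀ i, α i ≠ 0) {v : Fin n → K[X]}
    (hv : v ∈ wrsCode k δ γ fun i => algebraMap F K (α i)) (hv0 : coeffVec v 0 ≠ 0) (j : ℕ)
    (hj : j ≤ δ / k + δ / r) : r * (j + 1) + 1 ≤ truncWeight j v := by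
  classical
  have : NeZero k := ⟨hk.ne'⟩
  obtain ⟨u, rfl⟩ := hv
  set G := wrsMatrix k δ γ fun i => algebraMap F K (α i) with hG
  rw [vecMulLinear_apply] at hv0 ⊢
  set v := u ᵥ* G with hv
  induction j using Nat.strong_induction_on with
  | _ j ih =>
  by_contra! hlt
  set z : ℕ → ℕ := fun i => (Finset.univ.filter fun c => (v c).coeff i = 0).card with hz
  have hzt : ∀ a, ∑ i ∈ Finset.range (a + 1), z i + truncWeight a v = (a + 1) * n := by
    intro a
    rw [truncWeight, ← Finset.sum_add_distrib, ← smul_eq_mul, ← Finset.card_range (a + 1),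
      ← Finset.sum_const, Finset.card_range]
    refine Finset.sum_congr rfl fun i _ => ?_
    have := Finset.card_filter_add_card_filter_not (s := (Finset.univ : Finset (Fin n)))
      (fun c => (v c).coeff i = 0)
    rw [Finset.card_univ, Fintype.card_fin] at this
    refine Eq.trans ?_ this
    rfl
  set Z := (Finset.range ((j + 1) * n)).filter fun q =>
    (v (Fin.ofNat n q)).coeff (j - q / n) = 0 with hZ
  have hZc : Z.card = ∑ i ∈ Finset.range (j + 1), z i := by
    rw [hZ, card_filter_range_mul fun d c => (v c).coeff (j - d) = 0]
    have := Finset.sum_range_reflect z (j + 1)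
    rw [← this]
    exact Finset.sum_congr rfl fun d _ => by
      rw [hz, show j + 1 - 1 - d = j - d by omega]
  have hZs : ∀ s ≤ j, (Z.filter fun q => ¬ q < s * n).card
      = ∑ i ∈ Finset.range (j + 1 - s), z i := by
    intro s hs
    have h1 := Finset.card_filter_add_card_filter_not (s := Z) (fun q => q < s * n)
    have h2 : (Z.filter fun q => q < s * n)
        = (Finset.range (s * n)).filter fun q => (v (Fin.ofNat n q)).coeff (j - q / n) = 0 := by
      ext q
      have : s * n ≤ (j + 1) * n := Nat.mul_le_mul_right _ (by omega)
      simp only [hZ, Finset.mem_filter, Finset.mem_range]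
      constructor
      · rintro ⟨⟨-, h⟩, h'⟩
        exact ⟨h', h⟩
      · rintro ⟨h', h⟩
        exact ⟨⟨by omega, h⟩, h'⟩
    rw [h2, card_filter_range_mul fun d c => (v c).coeff (j - d) = 0, hZc] at h1
    have h3 : ∑ i ∈ Finset.range (j + 1), z i = ∑ d ∈ Finset.range s, z (j - d)
        + ∑ i ∈ Finset.range (j + 1 - s), z i := by
      rw [← Finset.sum_range_reflect, show j + 1 = s + (j + 1 - s) by omega,
        Finset.sum_range_add, ← Finset.sum_range_reflect z (s + (j + 1 - s) - s)]
      congr 1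
      · exact Finset.sum_congr rfl fun d _ => by congr 1; omega
      · rw [show s + (j + 1 - s) - s = j + 1 - s by omega]
        exact Finset.sum_congr rfl fun d _ => by congr 1; omega
    have h4 : ∀ d, z (j - d) = (Finset.univ.filter fun c => (v c).coeff (j - d) = 0).card :=
      fun _ => rfl
    simp only [h4] at h3
    omega
  have hcard : (j + 1) * k ≤ Z.card := by
    have h1 := hzt j
    have h2 : (j + 1) * n = (j + 1) * k + r * (j + 1) := by rw [← hn]; ring
    omega
  obtain ⟨S, hSZ, hSc⟩ := Finset.exists_subset_card_eq hcard
  have hmem : ∀ q ∈ S, q < (j + 1) * n ∧ (v (Fin.ofNat n q)).coeff (j - q / n) = 0 := fun q hq => by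
    simpa [hZ] using hSZ hq
  -- Blocks from `s` on are the times `0, …, j - s`. For `s > 0` the induction hypothesis leaves
  -- fewer than `(j - s + 1) * k` zeros there, so the remaining members of `S` lie in the first `s`
  -- blocks.
  have hcount : ∀ s ≤ j, s * k ≤ (S.filter (· < s * n)).card := by
    intro s hs
    have h1 := Finset.card_filter_add_card_filter_not (s := S) (fun q => q < s * n)
    have h2 := Finset.card_le_card (Finset.filter_subset_filter (fun q => ¬ q < s * n) hSZ)
    rw [hZs s hs] at h2
    rcases Nat.eq_zero_or_pos s with rfl | hs0
    · simp
    · obtain ⟨a, rfl⟩ : ∃ a, j = s + a := ⟨j - s, by omega⟩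
      rw [show s + a + 1 - s = a + 1 by omega] at h2
      have h3 := ih a (by omega) (by omega)
      have h4 := hzt a
      have h5 : (a + 1) * n = (a + 1) * k + r * (a + 1) := by rw [← hn]; ring
      have h6 : (s + a + 1) * k = s * k + (a + 1) * k := by ring
      omega
  have h0 := eq_zero_of_sliding_vecMul hn hk hr hγ hα hα0 hj hSc
    (fun q hq => Finset.mem_range.2 (hmem q hq).1) hcount
    (fun ρ => (u (Fin.ofNat k ρ).rev).coeff (j - ρ / k)) fun q hq => by
      obtain ⟨hq1, hq2⟩ := hmem q hq
      have hd : q / n ≤ j :=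
        Nat.lt_succ_iff.1 ((Nat.div_lt_iff_lt_mul (NeZero.pos n)).2 hq1)
      rw [← hq2, hv, hG, coeff_vecMul_wrsMatrix γ _ hδ u _ hd]
  -- Because of the time reversal, `u_0` sits in the last row block.
  have hu0 : ∀ a, (u a).coeff 0 = 0 := fun a => by
    have h1 := h0 (j * k + (a.rev : ℕ)) (by
      have := a.rev.2
      have : (j + 1) * k = j * k + k := by ring
      omega)
    rwa [ofNat_mul_add, mul_add_div_fin, Fin.rev_rev, Nat.sub_self] at h1
  refine hv0 (funext fun c => ?_)
  rw [coeffVec, hv, vecMul, dotProduct, finsetSum_coeff]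
  exact Finset.sum_eq_zero fun a _ => by rw [mul_coeff_zero, hu0, zero_mul]

theorem isMDP_wrsCode (hn : k + r = n) (hk : 0 < k) (hr : 0 < r) (hδ : 0 < δ)
    (hγ : AvoidsDegree F γ (degBound k δ (δ / r + 1)))
    (hα : Function.Injective α) (hα0 : ∀ i, α i ≠ 0) :
    IsMDP k δ (wrsCode k δ γ fun i => algebraMap F K (α i)) := by
  have : NeZero n := ⟨by omega⟩
  have hnk : n - k = r := by omega
  refine ⟨isConvCode_wrsCode (r := r) (by omega) hk hδ hγ hα hα0, fun j hj => ?_⟩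
  rw [hnk] at hj ⊢
  exact columnDistance_eq
    (fun v hv hv0 => le_truncWeight_of_mem_wrsCode hn hk hr hδ hγ hα hα0 hv hv0 j hj)
    (exists_mem_wrsCode_truncWeight_le hn hk hδ hα hα0 j)

end Code

/-! ## Dual WRS codes are MDP -/

section Kernel

variable {K : Type*} [Field K] {n k r : ℕ}

/-- A kernel of a surjective polynomial matrix `H` has a generator matrix whose full size minors
are, up to a unit, those of `H` bordered by rows of the identity matrix. -/
theorem exists_isGeneratorMatrix_ker (hn : r + k = n) (H : Matrix (Fin r) (Fin n) K[X])
    (hH : Function.Surjective H.mulVecLin) (e : Fin r ⊕ Fin k ≃ Fin n) :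
    ∃ (G : Matrix (Fin k) (Fin n) K[X]) (t : K[X]), IsUnit t ∧
      IsGeneratorMatrix (LinearMap.ker H.mulVecLin) G ∧
      ∀ c : Fin k → Fin n, (G.submatrix id c).det
        = ((fromRows H ((1 : Matrix (Fin n) (Fin n) K[X]).submatrix c id)).submatrix id e).det
          * t := by
  obtain ⟨g, hg⟩ := Module.projective_lifting_property H.mulVecLin LinearMap.id hH
  have hfr : Module.finrank K[X] (LinearMap.ker H.mulVecLin) = k := by
    have h1 := (H.mulVecLin).quotKerEquivOfSurjective hH |>.finrank_eq
    have h2 := Submodule.finrank_quotient_add_finrank (LinearMap.ker H.mulVecLin)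
    rw [h1, Module.finrank_fin_fun, Module.finrank_fin_fun] at h2
    omega
  let b := Module.finBasisOfFinrankEq K[X] (LinearMap.ker H.mulVecLin) hfr
  let A : Matrix (Fin n) (Fin r) K[X] := LinearMap.toMatrix' g
  let G : Matrix (Fin k) (Fin n) K[X] := Matrix.of fun j => (b j : Fin n → K[X])
  have hHA : H * A = 1 := by
    have h1 : LinearMap.toMatrix' (H.mulVecLin ∘ₗ g) = 1 := by rw [hg, LinearMap.toMatrix'_id]
    rw [LinearMap.toMatrix'_comp] at h1
    rwa [← Matrix.toLin'_apply', LinearMap.toMatrix'_toLin'] at h1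
  have hHG : H * Gᵀ = 0 := by
    refine Matrix.ext fun a j => ?_
    have h1 : H.mulVecLin (b j : Fin n → K[X]) = 0 := (b j).2
    exact congrFun h1 a
  have hrange : LinearMap.ker H.mulVecLin = LinearMap.range G.vecMulLinear := by
    have h1 := congrArg (Submodule.map (LinearMap.ker H.mulVecLin).subtype) b.span_eq
    rw [Submodule.map_span, Submodule.map_top, Submodule.range_subtype, ← Set.range_comp] at h1
    rw [range_vecMulLinear, ← h1]
    rfl
  -- `A` is a right inverse of `H`, so `v = A H v + (v - A H v)` splits the space into the image of
  -- `A` and the kernel of `H`.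
  have hsurj : Function.Surjective ((fromCols A Gᵀ).submatrix e id).mulVec := by
    intro y
    set v : Fin n → K[X] := y ∘ e.symm with hv
    have hker : v - A *ᵥ (H *ᵥ v) ∈ LinearMap.ker H.mulVecLin := by
      rw [LinearMap.mem_ker, mulVecLin_apply, mulVec_sub, mulVec_mulVec, hHA, one_mulVec, sub_self]
    rw [hrange] at hker
    obtain ⟨w, hw⟩ := hker
    refine ⟨Sum.elim (H *ᵥ v) w, ?_⟩
    have h1 : (fromCols A Gᵀ) *ᵥ Sum.elim (H *ᵥ v) w = v := by
      rw [fromCols_mulVec_sumElim, mulVec_transpose, ← vecMulLinear_apply, hw, add_sub_cancel]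
    ext1 i
    have h2 := congrFun h1 (e i)
    simp only [hv, Function.comp_apply, Equiv.symm_apply_apply] at h2
    exact h2
  have hunit : IsUnit ((fromCols A Gᵀ).submatrix e id).det := by
    rw [← isUnit_iff_isUnit_det]
    exact mulVec_surjective_iff_isUnit.1 hsurj
  refine ⟨G, _, hunit, ⟨?_, hrange⟩, fun c => ?_⟩
  · exact b.linearIndependent.map' (LinearMap.ker H.mulVecLin).subtype
      (Submodule.ker_subtype _)
  -- The bordered matrix times `[A Gᵀ]` is block lower triangular, with diagonal blocks `1` and the
  -- transposed submatrix of `G` on the columns `c`.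
  · rw [← det_mul, submatrix_mul_equiv, submatrix_id_id, fromRows_mul_fromCols, hHA, hHG,
      det_fromBlocks_zero₁₂, det_one, one_mul, ← det_transpose]
    congr 1
    ext i j
    simp [Matrix.mul_apply, Matrix.one_apply]

end Kernel

section Dual

variable {F K : Type*} [Field F] [Field K] [Algebra F K] {n k r δ : ℕ} {γ : K}
  {α : Fin n → F}

/-- Preimages of unit vectors are sought among vectors of degree at most `N = ⌈δ / r⌉ - 1`.
Comparing coefficients becomes a square sliding system in the first `M` columns, which
`det_entry_ne_zero` solves. -/
theorem surjective_mulVecLin_wrsMatrix (hn : k + r = n) (hk : 0 < k) (hr : 0 < r) (hδ : 0 < δ)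
    (hγ : AvoidsDegree F γ (degBound k δ (δ / r + 1)))
    (hα : Function.Injective α) (hα0 : ∀ i, α i ≠ 0) :
    Function.Surjective (wrsMatrix k δ γ fun i => algebraMap F K (α i)).mulVecLin := by
  have : NeZero n := ⟨by omega⟩
  set H := wrsMatrix k δ γ fun i => algebraMap F K (α i) with hH
  obtain ⟨N, hN⟩ : ∃ N, wrsMemory r δ = N + 1 := by
    have h := le_wrsMemory_mul (δ := δ) hr
    rcases Nat.eq_zero_or_pos (wrsMemory r δ) with h0 | h0
    · rw [h0] at h; omega
    · exact ⟨wrsMemory r δ - 1, by omega⟩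
  have hN1 : δ ≤ (N + 1) * r := hN ▸ le_wrsMemory_mul hr
  have hN2 : N * r < δ := by
    have := wrsMemory_pred_mul_lt hr hδ
    rwa [hN, Nat.add_sub_cancel] at this
  -- Rows from `M` on vanish on every block `d ≤ N`, so `M` equations are enough; `δ ≤ (N + 1) * r`
  -- ensures that there are at least `M` unknowns.
  set M := (N + 1) * k + δ with hM
  have hMn : M ≤ (N + 1) * n := by
    have : (N + 1) * n = (N + 1) * k + (N + 1) * r := by rw [← hn]; ring
    omega
  have hdiv : ∀ q < M, q / n ≤ N := fun q hq =>
    Nat.lt_succ_iff.1 ((Nat.div_lt_iff_lt_mul (NeZero.pos n)).2 (hq.trans_le hMn))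
  have hdet := det_entry_ne_zero (M := M) (d := fun c => (c : ℕ) / n)
    (x := fun c => α (Fin.ofNat n c)) hγ hk (by
      have h1 : N ≤ δ / r := (Nat.le_div_iff_mul_le hr).2 hN2.le
      have h2 : (N + 1) * k ≤ (δ / r + 1) * k := Nat.mul_le_mul_right _ (by omega)
      have h3 : (δ / r + 1) * k = k * (δ / r + 1) := mul_comm _ _
      omega)
    (fun a b hab => Nat.div_le_div_right hab)
    (fun i => by
      have h1 : (i : ℕ) / n * n ≤ i := Nat.div_mul_le_self _ _
      have h2 : (i : ℕ) < ((i : ℕ) / n + 1) * n :=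
        (Nat.div_lt_iff_lt_mul (NeZero.pos n)).1 (Nat.lt_succ_self _)
      have h3 := hdiv i i.2
      have h4 := i.2
      set d := (i : ℕ) / n
      have h5 : d * n = k * d + d * r := by rw [← hn]; ring
      have h6 : (d + 1) * n = k * d + k + (d * r + r) := by rw [← hn]; ring
      refine ⟨by omega, ?_⟩
      rcases Nat.lt_or_ge d N with h | h
      · have h7 : (d + 1) * r ≤ N * r := Nat.mul_le_mul_right _ h
        have h8 : (d + 1) * r = d * r + r := by ring
        omega
      · have h7 : (N + 1) * k = k * d + k := by rw [le_antisymm h h3]; ring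
        omega)
    (fun _ => hα0 _)
    (fun a b h1 h2 => Fin.ext (eq_of_div_eq_of_ofNat_eq h1 (hα h2)))
  have hsingle : ∀ a₀ : Fin k, ∃ v, H *ᵥ v = Pi.single a₀ 1 := by
    intro a₀
    have hunit := (isUnit_iff_isUnit_det _).2 (isUnit_iff_ne_zero.2 hdet)
    obtain ⟨y₀, hy₀⟩ := mulVec_surjective_iff_isUnit.2 hunit
      (fun i => if (i : ℕ) = (a₀.rev : ℕ) then 1 else 0)
    set y : ℕ → K := fun q => if h : q < M then y₀ ⟨q, h⟩ else 0 with hy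
    have hyM : ∀ q, M ≤ q → y q = 0 := fun q hq => dif_neg (not_lt.2 hq)
    have hsys : ∀ ρ < M, ∑ q ∈ Finset.range M,
        entry k δ γ ρ (q / n) (algebraMap F K (α (Fin.ofNat n q))) * y q
          = if ρ = (a₀.rev : ℕ) then 1 else 0 := by
      intro ρ hρ
      rw [← show _ = (if ρ = (a₀.rev : ℕ) then (1 : K) else 0) from congrFun hy₀ ⟨ρ, hρ⟩,
        ← Fin.sum_univ_eq_sum_range fun q =>
          entry k δ γ ρ (q / n) (algebraMap F K (α (Fin.ofNat n q))) * y q]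
      refine Finset.sum_congr rfl fun q _ => ?_
      rw [hy]
      simp only [q.2, dif_pos]
      rfl
    let v : Fin n → K[X] := fun c => ∑ i ∈ Finset.range (N + 1), monomial i (y (i * n + c))
    have hv : ∀ q, (v (Fin.ofNat n q)).coeff (q / n) = y q := by
      intro q
      have h1 : q / n * n + (Fin.ofNat n q : ℕ) = q := by
        rw [Fin.val_ofNat, Nat.div_add_mod']
      simp only [v, finsetSum_coeff, coeff_monomial, Finset.sum_ite_eq', Finset.mem_range, h1]
      split_ifs with h
      · rfl
      · refine (hyM q ?_).symm
        by_contra hq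
        exact h (Nat.lt_succ_iff.2 (hdiv q (not_le.1 hq)))
    refine ⟨v, funext fun a => Polynomial.ext fun l => ?_⟩
    rw [hH, coeff_mulVec_wrsMatrix γ _ hk hδ v a (Nat.le_add_right l N)]
    simp only [hv]
    have hsub : Finset.range M ⊆ Finset.range ((l + N + 1) * n) :=
      Finset.range_mono (hMn.trans (Nat.mul_le_mul_right _ (by omega)))
    rw [← Finset.sum_subset hsub fun q _ hq => by
      rw [hyM q (by simpa using hq), mul_zero]]
    have hif : (Pi.single a₀ (1 : K[X]) : Fin k → K[X]) a = if a = a₀ then 1 else 0 := by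
      rw [Pi.single_apply]
    rw [hif]
    have ha := a.rev.2
    have ha₀ := a₀.rev.2
    by_cases hl : l = 0
    · subst hl
      have hkM : k ≤ M := by
        have : (N + 1) * k = N * k + k := by ring
        omega
      rw [hsys _ (by omega)]
      have hiff : 0 * k + (a.rev : ℕ) = a₀.rev ↔ a = a₀ := by
        rw [zero_mul, zero_add, Fin.val_inj, Fin.rev_inj]
      simp only [hiff]
      split_ifs <;> simp
    · have h0 : (if a = a₀ then (1 : K[X]) else 0).coeff l = 0 := by
        split_ifs
        · rw [coeff_one, if_neg hl]
        · rw [coeff_zero]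
      rw [h0]
      have hlk : k ≤ l * k := Nat.le_mul_of_pos_left k (Nat.pos_of_ne_zero hl)
      rcases Nat.lt_or_ge (l * k + (a.rev : ℕ)) M with h | h
      · rw [hsys _ h, if_neg (by omega)]
      · refine Finset.sum_eq_zero fun q hq => ?_
        rw [entry_of_ge, zero_mul]
        have h1 : k * (q / n) ≤ k * N :=
          Nat.mul_le_mul_left _ (hdiv q (Finset.mem_range.1 hq))
        have h2 : (N + 1) * k = k * N + k := by ring
        omega
  choose v hv using hsingle
  intro y
  refine ⟨∑ a, y a • v a, ?_⟩
  rw [map_sum]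
  simp only [map_smul, mulVecLin_apply, hv]
  ext1 a
  simp [Finset.sum_apply, Pi.single_apply]

/-- Bordering `H` with constant rows of the identity keeps the sum of the row degrees at `δ`, which
bounds all minors of the kernel basis. -/
theorem isConvCode_dualWRSCode (hn : k + r = n) (hk : 0 < k) (hr : 0 < r) (hδ : 0 < δ)
    (hγ : AvoidsDegree F γ (degBound r δ (δ / k + 1)))
    (hα : Function.Injective α) (hα0 : ∀ i, α i ≠ 0) :
    IsConvCode k δ (LinearMap.ker (wrsMatrix r δ γ fun i => algebraMap F K (α i)).mulVecLin) := by
  set H := wrsMatrix r δ γ fun i => algebraMap F K (α i) with hH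
  have hrk : r + k = n := by omega
  let e : Fin r ⊕ Fin k ≃ Fin n := finSumFinEquiv.trans (finCongr hrk)
  obtain ⟨G, t, ht, hG, hdet⟩ := exists_isGeneratorMatrix_ker hrk H
    (surjective_mulVecLin_wrsMatrix (by omega) hr hk hδ hγ hα hα0) e
  refine ⟨G, hG, ?_⟩
  have ht0 := natDegree_eq_zero_of_isUnit ht
  let B : (Fin k → Fin n) → Matrix (Fin r ⊕ Fin k) (Fin r ⊕ Fin k) K[X] := fun c =>
    (fromRows H ((1 : Matrix (Fin n) (Fin n) K[X]).submatrix c id)).submatrix id e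
  have hnat : ∀ c : Fin k → Fin n, (G.submatrix id c).det.natDegree = (B c).det.natDegree := by
    intro c
    rw [hdet c]
    by_cases h0 : (B c).det = 0
    · rw [h0, zero_mul]
    · rw [natDegree_mul h0 ht.ne_zero, ht0, add_zero]
  let ν : Fin r ⊕ Fin k → ℕ := Sum.elim (fun a => (δ + (a : ℕ)) / r) fun _ => 0
  have hsum : ∑ i, ν i = δ := by
    rw [Fintype.sum_sum_type]
    simp only [ν, Sum.elim_inl, Sum.elim_inr, Finset.sum_const_zero, add_zero]
    rw [Fin.sum_univ_eq_sum_range fun a => (δ + a) / r, sum_add_div r δ hr]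
  have hB : ∀ c : Fin k → Fin n, (B c).det.natDegree ≤ δ ∧ (B c).det.coeff δ
      = (Matrix.of fun i j => (B c i j).coeff (ν i)).det := fun c => by
    have h := natDegree_det_le_and_coeff (B c) ν fun i j => by
      rcases i with a | b
      · exact natDegree_wrsMatrix_le hr hδ _ a (e j)
      · have h1 : B c (Sum.inr b) j = if c b = e j then 1 else 0 := by
          simp [B, Matrix.one_apply]
        rw [h1]
        split_ifs <;> simp
    rwa [hsum] at h
  -- Bordering at the last `k` columns makes the leading matrix block upper triangular, so the bound
  -- `δ` is attained through the leading minor of `H` on the first `r` columns.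
  let c₀ : Fin k ↪o Fin n := (Fin.natAddOrderEmb r).trans (Fin.castOrderIso hrk).toOrderEmbedding
  have hc₀ : ∀ b, c₀ b = e (Sum.inr b) := fun b => by
    ext
    simp [c₀, e]
  refine le_antisymm (Finset.sup_le fun c _ => ?_) ?_
  · rw [hnat]
    exact (hB c).1
  · refine le_trans ?_
      (Finset.le_sup (f := fun c : Fin k ↪o Fin n => (G.submatrix id c).det.natDegree)
        (Finset.mem_univ c₀))
    rw [hnat]
    refine le_natDegree_of_ne_zero ?_
    rw [(hB c₀).2]
    have h1 : (Matrix.of fun i j => (B c₀ i j).coeff (ν i))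
        = fromBlocks (Matrix.of fun a b : Fin r => (H a (e (Sum.inl b))).coeff ((δ + a) / r))
          (Matrix.of fun (a : Fin r) (b : Fin k) => (H a (e (Sum.inr b))).coeff ((δ + a) / r))
          0 1 := by
      ext i j
      rcases i with a | a <;> rcases j with b | b
      · rfl
      · rfl
      · simp [B, ν, hc₀]
      · simp only [B, ν, hc₀, of_apply, submatrix_apply, id, fromRows_apply_inr, Sum.elim_inr,
          fromBlocks_apply₂₂, Matrix.one_apply, EmbeddingLike.apply_eq_iff_eq, Sum.inr.injEq]
        split_ifs <;> simp
    rw [h1, det_fromBlocks_zero₂₁, det_one, mul_one]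
    exact det_leadingCoeff_ne_zero hr hδ (Nat.succ_pos _) hγ hα hα0 (fun b => e (Sum.inl b))
      (e.injective.comp Sum.inl_injective)

/-- Cramer's rule gives a codeword supported on the first `r` positions and one further position
`z`. Scaling by `f` makes its entry at `z` equal to `1` modulo `z ^ (j + 1)`, now with the code
variable `z`, so after time `0` only `r` positions remain up to time `j`. -/
theorem exists_mem_dualWRSCode_truncWeight_le (hn : k + r = n) (hk : 0 < k) (hr : 0 < r)
    (hδ : 0 < δ) (hα : Function.Injective α) (hα0 : ∀ i, α i ≠ 0) (j : ℕ) :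
    ∃ v ∈ LinearMap.ker (wrsMatrix r δ γ fun i => algebraMap F K (α i)).mulVecLin,
      coeffVec v 0 ≠ 0 ∧ truncWeight j v ≤ r * (j + 1) + 1 := by
  classical
  set H := wrsMatrix r δ γ fun i => algebraMap F K (α i) with hH
  let c₀ : Fin r ↪ Fin n := Fin.castLEEmb (by omega)
  obtain ⟨f, hf⟩ := exists_mul_det_wrsMatrix (γ := γ) hr hδ hα hα0 c₀ c₀.injective j
  rw [← hH] at hf
  let z : Fin n := ⟨r, by omega⟩
  have hz : ∀ b, c₀ b ≠ z := fun b h => by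
    have h1 : (b : ℕ) = r := congrArg Fin.val h
    have := b.2
    omega
  set Hr := H.submatrix id c₀ with hHr
  set w := Hr.adjugate *ᵥ H.col z with hw
  set v : Fin n → K[X] :=
    f • (Hr.det • Pi.single z 1 - ∑ b, w b • Pi.single (c₀ b) 1) with hv
  have hvz : v z = f * Hr.det := by
    have h1 : ∑ b, w b * (Pi.single (c₀ b) (1 : K[X]) : Fin n → K[X]) z = 0 :=
      Finset.sum_eq_zero fun b _ => by
        rw [Pi.single_eq_of_ne (hz b).symm, mul_zero]
    simp only [hv, Pi.smul_apply, Pi.sub_apply, Finset.sum_apply, smul_eq_mul, h1,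
      Pi.single_eq_same, mul_one, sub_zero]
  have hv0 : ∀ c, c ≠ z → (∀ b, c₀ b ≠ c) → v c = 0 := fun c hc hcb => by
    have h1 : ∑ b, w b * (Pi.single (c₀ b) (1 : K[X]) : Fin n → K[X]) c = 0 :=
      Finset.sum_eq_zero fun b _ => by
        rw [Pi.single_eq_of_ne (hcb b).symm, mul_zero]
    simp only [hv, Pi.smul_apply, Pi.sub_apply, Finset.sum_apply, smul_eq_mul, h1,
      Pi.single_eq_of_ne hc, mul_zero, sub_zero]
  have hcol : ∑ b, w b • H.col (c₀ b) = Hr.det • H.col z := by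
    have h1 : ∑ b, w b • H.col (c₀ b) = Hr *ᵥ w := by
      ext1 a
      simp [mulVec, dotProduct, hHr, mul_comm]
    rw [h1, hw, mulVec_mulVec, mul_adjugate, smul_mulVec, one_mulVec]
  refine ⟨v, ?_, ?_, ?_⟩
  · rw [LinearMap.mem_ker, hv, map_smul, map_sub, map_smul, map_sum]
    simp only [map_smul, mulVecLin_apply, mulVec_single_one]
    rw [hcol, sub_self, smul_zero]
  · intro h0
    have h1 := hf 0 (Nat.zero_le j)
    rw [if_pos rfl, ← hvz] at h1
    exact one_ne_zero (h1.symm.trans (congrFun h0 z))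
  · have hcard : (insert z (Finset.univ.map c₀)).card = r + 1 := by
      rw [Finset.card_insert_of_notMem, Finset.card_map, Finset.card_univ, Fintype.card_fin]
      intro h
      obtain ⟨b, -, hb⟩ := Finset.mem_map.1 h
      exact hz b hb
    have hmem : ∀ c, c ∉ Finset.univ.map c₀ → ∀ b, c₀ b ≠ c := fun c hc b hb =>
      hc (Finset.mem_map.2 ⟨b, Finset.mem_univ b, hb⟩)
    refine truncWeight_le v r j (insert z (Finset.univ.map c₀))ᶜ (Finset.univ.map c₀)ᶜ ?_ ?_ ?_ ?_
    · rw [Finset.card_compl, hcard, Fintype.card_fin]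
      omega
    · rw [Finset.card_compl, Finset.card_map, Finset.card_univ, Fintype.card_fin, Fintype.card_fin]
      omega
    · intro c hc
      rw [Finset.mem_compl, Finset.mem_insert, not_or] at hc
      rw [hv0 c hc.1 (hmem c hc.2), coeff_zero]
    · intro c hc i hi0 hij
      rw [Finset.mem_compl] at hc
      by_cases hcz : c = z
      · rw [hcz, hvz, hf i hij, if_neg hi0.ne']
      · rw [hv0 c hcz (hmem c hc), coeff_zero]

/-- A support of at most `r * (j + 1)` positions is enlarged to exactly that many columns of the
parity-check system. Lower bounds at earlier times give the count condition directly, and the code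
symbols on those columns must vanish. -/
theorem le_truncWeight_of_mem_dualWRSCode [NeZero n] (hn : k + r = n) (hk : 0 < k) (hr : 0 < r)
    (hδ : 0 < δ) (hγ : AvoidsDegree F γ (degBound r δ (δ / k + 1)))
    (hα : Function.Injective α) (hα0 : ∀ i, α i ≠ 0) {v : Fin n → K[X]}
    (hv : v ∈ LinearMap.ker (wrsMatrix r δ γ fun i => algebraMap F K (α i)).mulVecLin)
    (hv0 : coeffVec v 0 ≠ 0) (j : ℕ) (hj : j ≤ δ / k + δ / r) :
    r * (j + 1) + 1 ≤ truncWeight j v := by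
  classical
  have : NeZero r := ⟨hr.ne'⟩
  rw [LinearMap.mem_ker, mulVecLin_apply] at hv
  induction j using Nat.strong_induction_on with
  | _ j ih =>
  by_contra! hlt
  set Z := (Finset.range ((j + 1) * n)).filter fun q =>
    (v (Fin.ofNat n q)).coeff (q / n) ≠ 0 with hZ
  have hZc : Z.card = truncWeight j v := by
    rw [truncWeight_eq, hZ]
  have hrn : r * (j + 1) ≤ (j + 1) * n := by
    rw [mul_comm]
    exact Nat.mul_le_mul_left _ (by omega)
  obtain ⟨S, hZS, hS, hSc⟩ := Finset.exists_subsuperset_card_eq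
    (Finset.filter_subset _ _ : Z ⊆ Finset.range ((j + 1) * n)) (n := (j + 1) * r)
    (by rw [hZc, mul_comm]; omega) (by rw [Finset.card_range, mul_comm]; exact hrn)
  have hmem : ∀ q < (j + 1) * n, q ∉ S → (v (Fin.ofNat n q)).coeff (q / n) = 0 := by
    intro q hq hqS
    by_contra h
    exact hqS (hZS (Finset.mem_filter.2 ⟨Finset.mem_range.2 hq, h⟩))
  have hcount : ∀ s ≤ j, s * r ≤ (S.filter (· < s * n)).card := by
    intro s hs
    rcases s with _ | a
    · simp
    · have h1 := ih a (by omega) (by omega)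
      have h2 : truncWeight a v ≤ (S.filter (· < (a + 1) * n)).card := by
        rw [truncWeight_eq]
        refine Finset.card_le_card fun q hq => ?_
        obtain ⟨hq1, hq2⟩ := Finset.mem_filter.1 hq
        rw [Finset.mem_range] at hq1
        have h3 : (a + 1) * n ≤ (j + 1) * n := Nat.mul_le_mul_right _ (by omega)
        refine Finset.mem_filter.2 ⟨?_, hq1⟩
        by_contra hqS
        exact hq2 (hmem q (by omega) hqS)
      rw [mul_comm]
      omega
  have h0 := eq_zero_of_sliding_mulVec (by omega : r + k = n) hr hk hγ hα hα0
    (hj.trans (add_comm _ _).le) hSc hS hcount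
    (fun q => (v (Fin.ofNat n q)).coeff (q / n)) fun ρ hρ => by
      have hl : ρ / r ≤ j := Nat.lt_succ_iff.1 ((Nat.div_lt_iff_lt_mul hr).2 hρ)
      have h1 := coeff_mulVec_wrsMatrix γ (fun i => algebraMap F K (α i)) hr hδ v
        (Fin.ofNat r ρ).rev hl
      rw [hv, Pi.zero_apply, coeff_zero, Fin.rev_rev, Fin.val_ofNat, Nat.div_add_mod'] at h1
      rw [h1]
      refine Finset.sum_subset hS fun q hq hqS => ?_
      rw [hmem q (Finset.mem_range.1 hq) hqS, mul_zero]
  refine hv0 (funext fun c => ?_)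
  have h1 : (v (Fin.ofNat n (0 * n + c))).coeff ((0 * n + c) / n) = 0 := by
    by_cases hc : 0 * n + (c : ℕ) ∈ S
    · exact h0 _ hc
    · refine hmem _ ?_ hc
      have := c.2
      have : (j + 1) * n = j * n + n := by ring
      omega
  rwa [ofNat_mul_add, mul_add_div_fin] at h1

theorem isMDP_dualWRSCode (hn : k + r = n) (hk : 0 < k) (hr : 0 < r) (hδ : 0 < δ)
    (hγ : AvoidsDegree F γ (degBound r δ (δ / k + 1)))
    (hα : Function.Injective α) (hα0 : ∀ i, α i ≠ 0) :
    IsMDP k δ (dualWRSCode k δ γ fun i => algebraMap F K (α i)) := by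
  have : NeZero n := ⟨by omega⟩
  have hnk : n - k = r := by omega
  rw [IsMDP, dualWRSCode, hnk]
  exact ⟨isConvCode_dualWRSCode hn hk hr hδ hγ hα hα0, fun j hj => columnDistance_eq
    (fun v hv hv0 => le_truncWeight_of_mem_dualWRSCode hn hk hr hδ hγ hα hα0 hv hv0 j hj)
    (exists_mem_dualWRSCode_truncWeight_le hn hk hr hδ hα hα0 j)⟩

end Dual

/-! ## Existence of admissible data -/

theorem exists_wrsData {F K : Type*} [Field F] [Field K] [Algebra F K] {n q s : ℕ} (hq : n < q)
    (hF : Nat.card F = q) (hK : Nat.card K = q ^ s) :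
    ∃ (α : Fin n → F) (γ : K), WRSData s α γ := by
  have hq0 : q ≠ 0 := by omega
  have : Finite F := Nat.finite_of_card_ne_zero (by rwa [hF])
  have : Finite K := Nat.finite_of_card_ne_zero (by rw [hK]; exact pow_ne_zero _ hq0)
  have hq1 : 1 < q := hF ▸ Finite.one_lt_card
  have hfr : Module.finrank F K = s := by
    have h := Module.natCard_eq_pow_finrank (K := F) (V := K)
    rw [hF, hK] at h
    exact (Nat.pow_right_injective hq1 h).symm
  have hcard : Nat.card (Fin n) ≤ Nat.card Fˣ := by
    rw [Nat.card_fin, Nat.card_units, hF]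
    omega
  have : Fintype Fˣ := Fintype.ofFinite _
  obtain ⟨φ⟩ : Nonempty (Fin n ↪ Fˣ) := Function.Embedding.nonempty_of_card_le (by
    rwa [Nat.card_eq_fintype_card, Nat.card_eq_fintype_card] at hcard)
  obtain ⟨γ, hγ⟩ := Field.exists_primitive_element F K
  have hint : IsIntegral F γ := Algebra.IsIntegral.isIntegral γ
  refine ⟨fun i => φ i, γ, fun a b h => φ.injective (Units.ext h), fun i => (φ i).ne_zero,
    minpoly F γ, minpoly.irreducible hint, ?_, minpoly.aeval F γ⟩
  rw [← hfr, ← IntermediateField.adjoin.finrank hint, hγ, IntermediateField.finrank_top']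

end ConvCode

theorem mainTheorem3 {F K : Type*} [Field F] [Field K] [Algebra F K]
    (k n δ q s : ℕ) (hk : 0 < k) (hkn : k < n) (hδ : 0 < δ)
    (hq : n < q) (hF : Nat.card F = q) (hK : Nat.card K = q ^ s) :
    (∃ (α : Fin n → F) (γ : K), ConvCode.WRSData s α γ) ∧
    ((δ : ℝ) ^ 3 / 2 * (1 / ((n : ℝ) - k) + 1 / (3 * k))
        + (δ : ℝ) ^ 2 / 2 * (3 / 2 - 1 / ((n : ℝ) - k) - 1 / (2 * k))
        + (δ : ℝ) * ((k : ℝ) / 12 - 3 / 4) < (s : ℝ) →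
      ∀ (α : Fin n → F) (γ : K), ConvCode.WRSData s α γ →
        ConvCode.IsMDP k δ
          (ConvCode.wrsCode k δ γ (fun i => algebraMap F K (α i)))) ∧
    ((δ : ℝ) ^ 3 / 2 * (1 / (3 * ((n : ℝ) - k)) + 1 / k)
        + (δ : ℝ) ^ 2 / 2 * (3 / 2 - 1 / (2 * ((n : ℝ) - k)) - 1 / k)
        + (δ : ℝ) * (((n : ℝ) - k) / 12 - 3 / 4) < (s : ℝ) →
      ∀ (α : Fin n → F) (γ : K), ConvCode.WRSData s α γ →
        ConvCode.IsMDP k δ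
          (ConvCode.dualWRSCode k δ γ (fun i => algebraMap F K (α i)))) := by
  -- This `r` is `n - k - 1`; the codimension is `r + 1`.
  obtain ⟨r, rfl⟩ := Nat.exists_eq_add_of_lt hkn
  have hcast : ((k + r + 1 : ℕ) : ℝ) - k = ((r + 1 : ℕ) : ℝ) := by push_cast; ring
  rw [hcast]
  refine ⟨ConvCode.exists_wrsData hq hF hK, ?_, ?_⟩
  · rintro h α γ ⟨hα, hα0, f, hf, rfl, h0⟩
    exact ConvCode.isMDP_wrsCode (r := r + 1) (by omega) hk (Nat.succ_pos r) hδ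
      (ConvCode.avoidsDegree_of_irreducible hf h0 (ConvCode.degBound_lt k (r + 1) δ _ hk h)) hα hα0
  · rintro h α γ ⟨hα, hα0, f, hf, rfl, h0⟩
    refine ConvCode.isMDP_dualWRSCode (r := r + 1) (by omega) hk (Nat.succ_pos r) hδ
      (ConvCode.avoidsDegree_of_irreducible hf h0
        (ConvCode.degBound_lt (r + 1) k δ _ (Nat.succ_pos r) (lt_of_eq_of_lt ?_ h))) hα hα0
    ring
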